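/- For integers $n,w\ge 0$ with $2w\le n$, the binary Johnson space $\mathbb{F}_2^{n,w}$ is the set of vectors in $\mathbb{F}_2^n$ with exactly $w$ coordinates equal to $1$, with the distance $\tau(x,y)=\tfrac12\,|\{i : x_i\ne y_i\}|$. A finite set $X\subseteq \mathbb{F}_2^{n,w}$ is a three-distance set if $\{\tau(x,y) : x,y\in X,\ x\ne y\}$ has exactly three elements, and $A(\mathbb{F}_2^{n,w},3)$ denotes the maximum cardinality of a three-distance set in $\mathbb{F}_2^{n,w}$. 1. If $11\le n\le 45$ and $4\le w\le n/2$, then $$A(\mathbb{F}_2^{n,w},3)\le \binom n3-\binom n2+n .$$ 2. If $n$ and $w$ satisfy any of the conditions - $11\le n\le 12$ and $w=4$, - $13\le n\le 15$ and $4\le w\le 5$, - $16\le n\le 19$ and $4\le w\le 6$, - $20\le n\le 24$ and $4\le w\le 7$, - $25\le n\le 50$ and $4\le w\le 8$, then $A(\mathbb{F}_2^{n,w},3)=\binom{n-w+3}{3}$. -/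

import Mathlib

/-- `D(X)`: the set of values `τ x y` over pairs of distinct points of the finite set `X`. -/
def distanceSet {M : Type*} (τ : M → M → ℝ) (X : Finset M) : Set ℝ :=
  {t | ∃ x ∈ X, ∃ y ∈ X, x ≠ y ∧ τ x y = t}

/-- `X` is an `s`-distance set: exactly `s` distances occur between distinct points of `X`.
(`distanceSet τ X` is finite, since `X` is, so `Set.ncard` is its genuine cardinality.) -/
def IsSDistanceSet {M : Type*} (τ : M → M → ℝ) (s : ℕ) (X : Finset M) : Prop :=
  (distanceSet τ X).ncard = s

/-- `A(M, s)`: the maximum cardinality of an `s`-distance set in `M`. -/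
noncomputable def maxSDistance {M : Type*} (τ : M → M → ℝ) (s : ℕ) : ℕ :=
  sSup {m : ℕ | ∃ X : Finset M, IsSDistanceSet τ s X ∧ X.card = m}

/-- In a finite space that has an `s`-distance set, `maxSDistance` is an honest maximum. -/
theorem maxSDistance_isGreatest {M : Type*} [Finite M] (τ : M → M → ℝ) (s : ℕ)
    (h : ∃ X : Finset M, IsSDistanceSet τ s X) :
    IsGreatest {m : ℕ | ∃ X : Finset M, IsSDistanceSet τ s X ∧ X.card = m}
      (maxSDistance τ s) := by
  have := Fintype.ofFinite M
  have hb : BddAbove {m : ℕ | ∃ X : Finset M, IsSDistanceSet τ s X ∧ X.card = m} :=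
    ⟨Fintype.card M, by rintro _ ⟨X, -, rfl⟩; exact X.card_le_univ⟩
  obtain ⟨X, hX⟩ := h
  exact ⟨Nat.sSup_mem ⟨X.card, X, hX, rfl⟩ hb, fun m hm => le_csSup hb hm⟩

/-- The binary Johnson space `F_2^{n,w}`: vectors of length `n` over `F_2` with exactly `w`
nonzero coordinates, that is, with `w` ones. -/
abbrev JohnsonSpace (n w : ℕ) : Type :=
  {x : Fin n → ZMod 2 // hammingNorm x = w}

/-- The Johnson distance: half the number of coordinates in which `x` and `y` differ. -/
noncomputable def johnsonDist (n w : ℕ) (x y : JohnsonSpace n w) : ℝ :=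
  (hammingDist x.1 y.1 : ℝ) / 2

/-- `A(F_2^{n,w}, s)`. -/
noncomputable def johnsonA (n w s : ℕ) : ℕ :=
  maxSDistance (johnsonDist n w) s

/-!
A point of the Johnson space is identified with a `w`-subset of an `n`-set, and the distance of `S`
and `T` becomes `#(S \ T)`. Let a family `X` of `w`-sets have the distances `d < e < f`.

*Integrality.* Quadratic polynomials in the distance, as matrices on `X`, have rank at most
`n.choose 2`. If `X` is larger, then the polynomial `(e - t) (f - t)` gives a singular matrix, so
that the `0/1` matrix of the pairs at distance `d` has the rational eigenvalue
`-e f / ((e - d) (f - d))`. It is an algebraic integer, hence an integer. The same holds for `e` and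
`f` (`dvd_of_choose_two_lt_card`). Few triples of distances pass this test.

*Zonal functions.* The kernel that sums, over `k` disjoint pairs `(a, b)` of points, the products of
`(1_S a - 1_S b) (1_T a - 1_T b)` is positive semidefinite, and it depends on `#(S \ T)` only: it is
a positive multiple of the polynomial `hahn n w k` of degree `k` (`pairKernel_eq`,
`sum_hahn_nonneg`). A function of the distance that is nonpositive on the distances of `X` and has a
positive constant coefficient and nonnegative further coefficients in the zonal functions therefore
bounds the size of `X` (`linear_programming_bound`).

*Harmonic bound.* The annihilator polynomial `(d - t) (e - t) (f - t)` is a multiple of the identity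
matrix on `X`. If its zonal coefficient of degree two is nonpositive, then no nonzero weighting of
`X` is annihilated by the zonal spaces of degrees zero, one and three together. Their joint
dimension is at most `n.choose 3 - n.choose 2 + n`: degrees zero and one are spanned by the `n`
coordinate functions, and degree three is controlled by the cokernel of the inclusion map from
functions on pairs to functions on triples, which is injective
(`card_le_of_zonalCoeffTwo_nonpos`).

In the ranges of the theorem there are finitely many lengths, weights and integral triples of
distances. In each of these cases the harmonic bound applies or a linear programming certificate of
one of three kinds exists: the linear one for the minimum distance, the annihilator polynomial, or
the combination of three zonal functions and a constant that vanishes at `d`, `e`, `f`. The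
existence is decided by evaluation in the kernel (`harmonicTest_eq_true`, `starTest_eq_true`). For the exact
value, the family of all `w`-sets that contain a given `(w - 3)`-set has the distances `1, 2, 3`.
-/

open Finset

/-! ### Positive semidefinite zonal kernels -/

section Kernel

variable {α : Type*} [DecidableEq α]

/-- The difference of the values at `a` and `b` of the indicator function of `S`. -/
def indicatorDiff (S : Finset α) (a b : α) : ℚ :=
  (if a ∈ S then 1 else 0) - (if b ∈ S then 1 else 0)

/-- The sum, over sequences of `k` disjoint ordered pairs `(a, b)` of points of `A`, of the products
of `indicatorDiff S a b * indicatorDiff T a b`. Pairs with `a = b` are admitted in the sums; they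
contribute zero. -/
def pairKernel (S T : Finset α) : ℕ → Finset α → ℚ
  | 0, _ => 1
  | k + 1, A => ∑ a ∈ A, ∑ b ∈ A,
      indicatorDiff S a b * indicatorDiff T a b * pairKernel S T k ((A.erase a).erase b)

theorem pairKernel_nonneg (X : Finset (Finset α)) (k : ℕ) :
    ∀ (A : Finset α) (c : Finset α → ℚ),
      0 ≤ ∑ S ∈ X, ∑ T ∈ X, c S * c T * pairKernel S T k A := by
  induction k with
  | zero =>
    intro A c
    simp only [pairKernel, mul_one, ← Finset.sum_mul_sum]
    exact mul_self_nonneg _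
  | succ k ih =>
    intro A c
    have h : ∑ S ∈ X, ∑ T ∈ X, c S * c T * pairKernel S T (k + 1) A =
        ∑ a ∈ A, ∑ b ∈ A, ∑ S ∈ X, ∑ T ∈ X, (c S * indicatorDiff S a b) *
          (c T * indicatorDiff T a b) * pairKernel S T k ((A.erase a).erase b) := by
      simp only [pairKernel, Finset.mul_sum]
      calc _ = ∑ S ∈ X, ∑ a ∈ A, ∑ T ∈ X, ∑ b ∈ A, _ :=
            Finset.sum_congr rfl fun S _ => Finset.sum_comm
        _ = ∑ a ∈ A, ∑ S ∈ X, ∑ T ∈ X, ∑ b ∈ A, _ := Finset.sum_comm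
        _ = ∑ a ∈ A, ∑ S ∈ X, ∑ b ∈ A, ∑ T ∈ X, _ :=
            Finset.sum_congr rfl fun a _ => Finset.sum_congr rfl fun S _ => Finset.sum_comm
        _ = ∑ a ∈ A, ∑ b ∈ A, ∑ S ∈ X, ∑ T ∈ X, _ :=
            Finset.sum_congr rfl fun a _ => Finset.sum_comm
        _ = _ := by
            refine Finset.sum_congr rfl fun a _ => Finset.sum_congr rfl fun b _ =>
              Finset.sum_congr rfl fun S _ => Finset.sum_congr rfl fun T _ => ?_
            ring
    rw [h]
    exact Finset.sum_nonneg fun a _ => Finset.sum_nonneg fun b _ => ih _ _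

/-- The dual Hahn polynomial in the cardinalities of the four cells that two sets `S` and `T` cut
out: `i` for `S ∩ T`, `p` for `S \ T`, `r` for `T \ S` and `m` for the complement of `S ∪ T`. In a
product of `k` differences, `x.1` of the pairs join `S \ T` to `T \ S`, with sign `-1`, and the
`x.2` others join `S ∩ T` to the complement. -/
def dualHahn (k i p r m : ℕ) : ℤ :=
  ∑ x ∈ antidiagonal k, (k.choose x.1 : ℤ) * ((-1) ^ x.1 *
    ((p.descFactorial x.1 * r.descFactorial x.1 : ℕ) : ℤ) *
    ((i.descFactorial x.2 * m.descFactorial x.2 : ℕ) : ℤ))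

theorem cast_descFactorial_succ' (n k : ℕ) :
    (n.descFactorial (k + 1) : ℤ) = n * ((n - 1).descFactorial k : ℤ) := by
  cases n with
  | zero => simp
  | succ n => rw [Nat.succ_descFactorial_succ]; push_cast; simp

theorem dualHahn_succ (k i p r m : ℕ) :
    dualHahn (k + 1) i p r m =
      i * m * dualHahn k (i - 1) p r (m - 1) - p * r * dualHahn k i (p - 1) (r - 1) m := by
  unfold dualHahn
  rw [Finset.sum_antidiagonal_choose_succ_mul (fun x y => (-1 : ℤ) ^ x *
    ((p.descFactorial x * r.descFactorial x : ℕ) : ℤ) *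
    ((i.descFactorial y * m.descFactorial y : ℕ) : ℤ)), Finset.mul_sum, Finset.mul_sum,
    sub_eq_add_neg, ← Finset.sum_neg_distrib]
  congr 1
  · refine Finset.sum_congr rfl fun x _ => ?_
    push_cast
    rw [cast_descFactorial_succ' i, cast_descFactorial_succ' m]
    ring
  · refine Finset.sum_congr rfl fun x hx => ?_
    rw [← Nat.choose_symm_of_eq_add (mem_antidiagonal.1 hx).symm]
    push_cast
    rw [cast_descFactorial_succ' p, cast_descFactorial_succ' r]
    ring

theorem sum_sum_ite_ite (A P Q : Finset α) (g : ℚ) :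
    ∑ a ∈ A, ∑ b ∈ A, (if a ∈ P then 1 else 0) * (if b ∈ Q then 1 else 0) * g =
      #(A ∩ P) * #(A ∩ Q) * g := by
  simp only [← Finset.sum_mul, ← Finset.mul_sum]
  simp [Finset.sum_ite_mem]

/-- The factor `2 ^ k` counts the orientations of the pairs. -/
theorem pairKernel_eq [Fintype α] (S T : Finset α) (k : ℕ) : ∀ A : Finset α,
    pairKernel S T k A = 2 ^ k * (dualHahn k #(A ∩ (S ∩ T)) #(A ∩ (S \ T)) #(A ∩ (T \ S))
      #(A ∩ (S ∪ T)ᶜ) : ℚ) := by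
  induction k with
  | zero => intro A; simp [pairKernel, dualHahn]
  | succ k ih =>
    intro A
    set g₁ : ℚ := ((dualHahn k (#(A ∩ (S ∩ T)) - 1) #(A ∩ (S \ T)) #(A ∩ (T \ S))
      (#(A ∩ (S ∪ T)ᶜ) - 1) : ℤ) : ℚ) with hg₁
    set g₂ : ℚ := ((dualHahn k #(A ∩ (S ∩ T)) (#(A ∩ (S \ T)) - 1) (#(A ∩ (T \ S)) - 1)
      #(A ∩ (S ∪ T)ᶜ) : ℤ) : ℚ) with hg₂
    have key : ∀ a ∈ A, ∀ b ∈ A,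
        indicatorDiff S a b * indicatorDiff T a b * pairKernel S T k ((A.erase a).erase b) =
        (if a ∈ S ∩ T then 1 else 0) * (if b ∈ (S ∪ T)ᶜ then 1 else 0) * (2 ^ k * g₁) +
        (if a ∈ (S ∪ T)ᶜ then 1 else 0) * (if b ∈ S ∩ T then 1 else 0) * (2 ^ k * g₁) +
        ((if a ∈ S \ T then 1 else 0) * (if b ∈ T \ S then 1 else 0) * (-(2 ^ k * g₂)) +
        (if a ∈ T \ S then 1 else 0) * (if b ∈ S \ T then 1 else 0) * (-(2 ^ k * g₂))) := by
      intro a ha b hb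
      rw [ih]
      by_cases h1 : a ∈ S <;> by_cases h2 : a ∈ T <;> by_cases h3 : b ∈ S <;>
        by_cases h4 : b ∈ T <;>
        simp [indicatorDiff, h1, h2, h3, h4, hg₁, hg₂, ha, hb,
          Finset.card_erase_of_mem]
    rw [pairKernel, Finset.sum_congr rfl fun a ha => Finset.sum_congr rfl fun b hb => key a ha b hb]
    simp only [Finset.sum_add_distrib, sum_sum_ite_ite, dualHahn_succ]
    push_cast
    rw [← hg₁, ← hg₂]
    ring

end Kernel

/-! ### The linear programming bound -/

section Johnson

variable {α : Type*} [DecidableEq α] [Fintype α]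

/-- The zonal function of degree `k` on the Johnson scheme of `w`-subsets of an `n`-set, up to a
positive factor, as a function of the Johnson distance `t`. -/
def hahn (n w k t : ℕ) : ℤ := dualHahn k (w - t) t t (n - w - t)

theorem pairKernel_univ {S T : Finset α} {n w : ℕ} (hn : Fintype.card α = n) (hS : #S = w)
    (hT : #T = w) (k : ℕ) :
    pairKernel S T k univ = 2 ^ k * (hahn n w k #(S \ T) : ℚ) := by
  have h1 : #(T \ S) = #(S \ T) := Finset.card_sdiff_comm (hT.trans hS.symm)
  have h2 : #(S ∩ T) = w - #(S \ T) := by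
    have := Finset.card_sdiff_add_card_inter S T; omega
  have h3 : #(S ∪ T)ᶜ = n - w - #(S \ T) := by
    have := Finset.card_sdiff_add_card S T
    rw [Finset.card_compl]; omega
  rw [pairKernel_eq, Finset.univ_inter, Finset.univ_inter, Finset.univ_inter, Finset.univ_inter,
    h1, h2, h3, hahn]

theorem sum_hahn_nonneg {X : Finset (Finset α)} {n w : ℕ} (hn : Fintype.card α = n)
    (hX : ∀ S ∈ X, #S = w) (k : ℕ) (c : Finset α → ℚ) :
    0 ≤ ∑ S ∈ X, ∑ T ∈ X, c S * c T * (hahn n w k #(S \ T) : ℚ) := by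
  have h := pairKernel_nonneg X k univ c
  have h2 : ∑ S ∈ X, ∑ T ∈ X, c S * c T * pairKernel S T k univ =
      2 ^ k * ∑ S ∈ X, ∑ T ∈ X, c S * c T * (hahn n w k #(S \ T) : ℚ) := by
    simp only [Finset.mul_sum]
    refine Finset.sum_congr rfl fun S hS => Finset.sum_congr rfl fun T hT => ?_
    rw [pairKernel_univ hn (hX S hS) (hX T hT)]
    ring
  rw [h2] at h
  exact nonneg_of_mul_nonneg_right h (by positivity)

/-- Delsarte's linear programming bound, with three zonal functions in the certificate. -/
theorem linear_programming_bound {X : Finset (Finset α)} {n w : ℕ} (hn : Fintype.card α = n)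
    (hX : ∀ S ∈ X, #S = w) (hne : X.Nonempty) (k : Fin 3 → ℕ) (l₀ : ℚ) (l : Fin 3 → ℚ)
    (hl : ∀ i, 0 ≤ l i)
    (hneg : ∀ S ∈ X, ∀ T ∈ X, S ≠ T → l₀ + ∑ i, l i * hahn n w (k i) #(S \ T) ≤ 0) :
    l₀ * #X ≤ l₀ + ∑ i, l i * hahn n w (k i) 0 := by
  have h1 : l₀ * #X * #X ≤ ∑ S ∈ X, ∑ T ∈ X, (l₀ + ∑ i, l i * (hahn n w (k i) #(S \ T) : ℚ)) := by
    simp only [Finset.sum_add_distrib, Finset.sum_const, nsmul_eq_mul]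
    have : 0 ≤ ∑ S ∈ X, ∑ T ∈ X, ∑ i, l i * (hahn n w (k i) #(S \ T) : ℚ) := by
      rw [Finset.sum_congr rfl fun S _ => Finset.sum_comm, Finset.sum_comm]
      refine Finset.sum_nonneg fun i _ => ?_
      simp only [← Finset.mul_sum]
      refine mul_nonneg (hl i) ?_
      simpa using sum_hahn_nonneg hn hX (k i) (fun _ => 1)
    linarith
  have h2 : ∑ S ∈ X, ∑ T ∈ X, (l₀ + ∑ i, l i * (hahn n w (k i) #(S \ T) : ℚ)) ≤
      ∑ S ∈ X, (l₀ + ∑ i, l i * (hahn n w (k i) 0 : ℚ)) := by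
    refine Finset.sum_le_sum fun S hS => ?_
    rw [← Finset.add_sum_erase X _ hS, Finset.sdiff_self, Finset.card_empty]
    have : ∑ T ∈ X.erase S, (l₀ + ∑ i, l i * (hahn n w (k i) #(S \ T) : ℚ)) ≤ 0 :=
      Finset.sum_nonpos fun T hT =>
        hneg S hS T (Finset.mem_of_mem_erase hT) (Finset.ne_of_mem_erase hT).symm
    linarith
  rw [Finset.sum_const, nsmul_eq_mul] at h2
  have hpos : (0 : ℚ) < #X := by exact_mod_cast hne.card_pos
  nlinarith [h1.trans h2]

end Johnson

/-! ### Rational eigenvalues and solutions of small linear systems -/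

section Eigenvalue

/-- A rational eigenvalue of an integer matrix is an integer. -/
theorem exists_int_of_mulVec_eq {ι : Type*} [Fintype ι] [DecidableEq ι] (A : Matrix ι ι ℤ)
    (c : ι → ℚ) (hc : c ≠ 0) (μ : ℚ)
    (h : Matrix.mulVec (A.map (Int.cast : ℤ → ℚ)) c = μ • c) : ∃ z : ℤ, (z : ℚ) = μ := by
  have hdet : (Matrix.scalar ι μ - A.map (Int.cast : ℤ → ℚ)).det = 0 := by
    rw [← Matrix.exists_mulVec_eq_zero_iff]
    refine ⟨c, hc, ?_⟩
    rw [Matrix.sub_mulVec, h, Matrix.scalar_apply, ← Matrix.smul_one_eq_diagonal,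
      Matrix.smul_mulVec, Matrix.one_mulVec, sub_self]
  have hroot : Polynomial.aeval μ A.charpoly = 0 := by
    rw [← Matrix.eval_charpoly] at hdet
    have := Matrix.charpoly_map A (Int.castRingHom ℚ)
    rw [Polynomial.aeval_def, ← Polynomial.eval_map]
    rw [show (algebraMap ℤ ℚ) = Int.castRingHom ℚ from rfl, ← this]
    exact hdet
  obtain ⟨z, hz⟩ := IsIntegrallyClosed.isIntegral_iff.1
    (⟨A.charpoly, A.charpoly_monic, hroot⟩ : IsIntegral ℤ μ)
  exact ⟨z, by simpa using hz⟩

/-- Fewer than `#X` linear conditions on functions supported on `X` have a nonzero solution. -/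
theorem exists_mem_ne_zero_of_finrank_lt_card {β V : Type*} [Fintype β] [DecidableEq β]
    [AddCommGroup V] [Module ℚ V] [FiniteDimensional ℚ V] (X : Finset β) (L : (β → ℚ) →ₗ[ℚ] V)
    (h : Module.finrank ℚ V < #X) :
    ∃ c : β → ℚ, (∃ x ∈ X, c x ≠ 0) ∧ (∀ x ∉ X, c x = 0) ∧ L c = 0 := by
  let E : (X → ℚ) →ₗ[ℚ] (β → ℚ) := Function.ExtendByZero.linearMap ℚ (Subtype.val : X → β)
  have hker : LinearMap.ker (L ∘ₗ E) ≠ ⊥ := by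
    apply LinearMap.ker_ne_bot_of_finrank_lt
    simpa using h
  obtain ⟨c, hc, hc0⟩ := Submodule.exists_mem_ne_zero_of_ne_bot hker
  obtain ⟨x, hx⟩ := Function.ne_iff.1 hc0
  refine ⟨E c, ⟨x, x.2, ?_⟩, fun y hy => ?_, hc⟩
  · have hE : E c x = c x := Subtype.val_injective.extend_apply _ _ _
    rw [hE]
    exact hx
  · exact Function.extend_apply' _ _ _ (by rintro ⟨a, rfl⟩; exact hy a.2)

end Eigenvalue

/-! ### Integrality of the Lagrange coefficients -/

section Integrality

variable {α : Type*} [DecidableEq α]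

theorem sum_mul_card_inter_eq_zero {X : Finset (Finset α)} {c : Finset α → ℚ}
    (hpt : ∀ a, ∑ T ∈ X, c T * (if a ∈ T then 1 else 0) = 0) (S : Finset α) :
    ∑ T ∈ X, c T * (#(S ∩ T) : ℚ) = 0 := by
  have h1 : ∑ a ∈ S, ∑ T ∈ X, c T * (if a ∈ T then (1 : ℚ) else 0) = 0 :=
    Finset.sum_eq_zero fun a _ => hpt a
  rw [Finset.sum_comm] at h1
  rw [← h1]
  refine Finset.sum_congr rfl fun T _ => ?_
  rw [← Finset.mul_sum, Finset.sum_boole, Finset.filter_mem_eq_inter]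

variable [Fintype α]

theorem sum_eq_zero_of_point_sums {X : Finset (Finset α)} {w : ℕ} (hw : 1 ≤ w)
    (hX : ∀ S ∈ X, #S = w) {c : Finset α → ℚ}
    (hpt : ∀ a, ∑ T ∈ X, c T * (if a ∈ T then 1 else 0) = 0) : ∑ T ∈ X, c T = 0 := by
  have h1 : ∑ a : α, ∑ T ∈ X, c T * (if a ∈ T then (1 : ℚ) else 0) = 0 :=
    Finset.sum_eq_zero fun a _ => hpt a
  rw [Finset.sum_comm] at h1
  have h2 : ∀ T ∈ X, ∑ a : α, c T * (if a ∈ T then (1 : ℚ) else 0) = w * c T := by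
    intro T hT
    rw [← Finset.mul_sum, Finset.sum_boole, Finset.filter_univ_mem, hX T hT, mul_comm]
  rw [Finset.sum_congr rfl h2, ← Finset.mul_sum] at h1
  exact (mul_eq_zero.1 h1).resolve_left (Nat.cast_ne_zero.2 (by omega))

/-- If a weighting of the family `X` of `w`-sets sums to zero on the members of `X` that contain any
given pair of points, then it is orthogonal to all quadratic polynomials in the distance from a
given `w`-set. -/
theorem sum_quadratic_eq_zero {X : Finset (Finset α)} {w : ℕ} (hw : 2 ≤ w) (hX : ∀ S ∈ X, #S = w)
    (c : Finset α → ℚ) (hc : ∀ P : Finset α, #P = 2 → ∑ T ∈ X, c T * (if P ⊆ T then 1 else 0) = 0)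
    {S : Finset α} (hS : #S = w) (e f : ℚ) :
    ∑ T ∈ X, c T * ((e - #(S \ T)) * (f - #(S \ T))) = 0 := by
  have hpt : ∀ a, ∑ T ∈ X, c T * (if a ∈ T then 1 else 0) = 0 := by
    intro a
    have h1 : ∑ b ∈ univ.erase a, ∑ T ∈ X, c T * (if {a, b} ⊆ T then (1 : ℚ) else 0) = 0 :=
      Finset.sum_eq_zero fun b hb => hc _ (Finset.card_pair (Finset.ne_of_mem_erase hb).symm)
    rw [Finset.sum_comm] at h1
    have h2 : ∀ T ∈ X, ∑ b ∈ univ.erase a, c T * (if {a, b} ⊆ T then (1 : ℚ) else 0) =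
        (w - 1) * (c T * (if a ∈ T then 1 else 0)) := by
      intro T hT
      rw [← Finset.mul_sum]
      by_cases ha : a ∈ T
      · have : ∑ b ∈ univ.erase a, (if {a, b} ⊆ T then (1 : ℚ) else 0) = #(T.erase a) := by
          rw [Finset.sum_boole]
          congr 2
          ext b
          simp [Finset.insert_subset_iff, ha]
        rw [this, Finset.card_erase_of_mem ha, hX T hT, Nat.cast_sub (by omega)]
        simp [ha]; ring
      · simp [Finset.insert_subset_iff, ha]
    rw [Finset.sum_congr rfl h2, ← Finset.mul_sum] at h1
    refine (mul_eq_zero.1 h1).resolve_left ?_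
    have : (2 : ℚ) ≤ w := by exact_mod_cast hw
    linarith
  have hone := sum_eq_zero_of_point_sums (by omega) hX hpt
  have hlin := sum_mul_card_inter_eq_zero hpt S
  have hquad : ∑ T ∈ X, c T * ((#(S ∩ T)).choose 2 : ℚ) = 0 := by
    have h1 : ∑ P ∈ S.powersetCard 2, ∑ T ∈ X, c T * (if P ⊆ T then (1 : ℚ) else 0) = 0 :=
      Finset.sum_eq_zero fun P hP => hc P (Finset.mem_powersetCard.1 hP).2
    rw [Finset.sum_comm] at h1
    rw [← h1]
    refine Finset.sum_congr rfl fun T _ => ?_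
    rw [← Finset.mul_sum, Finset.sum_boole, ← Finset.card_powersetCard]
    congr 3
    ext P
    simp only [Finset.mem_powersetCard, Finset.mem_filter, Finset.subset_inter_iff]
    tauto
  have hexp : ∀ T ∈ X, c T * ((e - #(S \ T)) * (f - #(S \ T))) =
      2 * (c T * ((#(S ∩ T)).choose 2 : ℚ)) + (e + f - 2 * w + 1) * (c T * (#(S ∩ T) : ℚ)) +
        (e - w) * (f - w) * c T := by
    intro T _
    have h : (#(S \ T) : ℚ) = w - #(S ∩ T) := by
      have := Finset.card_sdiff_add_card_inter S T
      rw [hS] at this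
      rw [← this]; push_cast; ring
    rw [h, Nat.cast_choose_two]
    ring
  rw [Finset.sum_congr rfl hexp]
  simp only [Finset.sum_add_distrib, ← Finset.mul_sum, hone, hlin, hquad]
  ring

/-- The Larman–Rogers–Seidel integrality condition: in a three-distance family with more than
`n.choose 2` members, the Lagrange coefficient at `0` of each distance is an integer. -/
theorem dvd_of_choose_two_lt_card {X : Finset (Finset α)} {w : ℕ} (hw : 2 ≤ w)
    (hX : ∀ S ∈ X, #S = w) {d e f : ℕ} (hde : d ≠ e) (hdf : d ≠ f)
    (hd : ∀ S ∈ X, ∀ T ∈ X, S ≠ T → #(S \ T) = d ∨ #(S \ T) = e ∨ #(S \ T) = f)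
    (hcard : (Fintype.card α).choose 2 < #X) :
    ((e : ℤ) - d) * (f - d) ∣ (e : ℤ) * f := by
  let L : (Finset α → ℚ) →ₗ[ℚ] ({P : Finset α // #P = 2} → ℚ) :=
    { toFun := fun c P => ∑ T ∈ X, c T * (if P.1 ⊆ T then 1 else 0)
      map_add' := fun c c' => by
        ext P; simp only [Pi.add_apply, add_mul, Finset.sum_add_distrib]
      map_smul' := fun r c => by ext P; simp [Finset.mul_sum] }
  obtain ⟨c, ⟨S₀, hS₀, hcS⟩, -, hLc⟩ := exists_mem_ne_zero_of_finrank_lt_card X L (by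
    rwa [Module.finrank_fintype_fun_eq_card, Fintype.card_finset_len])
  have hc : ∀ P : Finset α, #P = 2 → ∑ T ∈ X, c T * (if P ⊆ T then 1 else 0) = 0 :=
    fun P hP => congrFun hLc ⟨P, hP⟩
  have hR : ((e : ℚ) - d) * (f - d) ≠ 0 := mul_ne_zero
    (sub_ne_zero.2 (by exact_mod_cast hde.symm)) (sub_ne_zero.2 (by exact_mod_cast hdf.symm))
  let A : Matrix X X ℤ := Matrix.of fun S T => if S.1 ≠ T.1 ∧ #(S.1 \ T.1) = d then 1 else 0
  obtain ⟨z, hz⟩ := exists_int_of_mulVec_eq A (fun S => c S)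
    (Function.ne_iff.2 ⟨⟨S₀, hS₀⟩, hcS⟩) (-((e * f : ℚ) / ((e - d) * (f - d)))) (by
      ext S
      have h0 := sum_quadratic_eq_zero hw hX c hc (hX S S.2) e f
      have h1 : ∀ T ∈ X, c T * (((e : ℚ) - #(S.1 \ T)) * (f - #(S.1 \ T))) =
          e * f * (if S.1 = T then c T else 0) +
            (e - d) * (f - d) * ((if S.1 ≠ T ∧ #(S.1 \ T) = d then 1 else 0) * c T) := by
        intro T hT
        by_cases hST : S.1 = T
        · subst hST; simp; ring
        · by_cases hq : #(S.1 \ T) = d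
          · simp [hST, hq]; ring
          · obtain h | h | h := hd S S.2 T hT hST
            · exact absurd h hq
            · simp [hST, h, hde.symm]
            · simp [hST, h, hdf.symm]
      rw [Finset.sum_congr rfl h1, Finset.sum_add_distrib, ← Finset.mul_sum, ← Finset.mul_sum,
        Finset.sum_ite_eq, if_pos S.2] at h0
      have h2 : Matrix.mulVec (A.map (Int.cast : ℤ → ℚ)) (fun S => c S) S =
          ∑ T ∈ X, (if S.1 ≠ T ∧ #(S.1 \ T) = d then 1 else 0) * c T := by
        rw [← Finset.sum_coe_sort X]
        refine Finset.sum_congr rfl fun T _ => ?_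
        simp [A]
      rw [h2, Pi.smul_apply, smul_eq_mul, neg_mul, div_mul_eq_mul_div, ← neg_div, eq_div_iff hR]
      linarith)
  refine ⟨-z, ?_⟩
  have : (e * f : ℚ) = (e - d) * (f - d) * (-z) := by
    rw [hz, neg_neg, mul_div_cancel₀ _ hR]
  exact_mod_cast this

end Integrality

/-! ### Functions on pairs and on triples -/

section CubicDefect

variable {α : Type*} [DecidableEq α]

theorem indicator_triple (T : Finset α) (a b c : α) :
    (if ({a, b, c} : Finset α) ⊆ T then (1 : ℚ) else 0) =
      (if a ∈ T then 1 else 0) * (if b ∈ T then 1 else 0) * (if c ∈ T then 1 else 0) := by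
  simp only [Finset.insert_subset_iff, Finset.singleton_subset_iff]
  by_cases a ∈ T <;> by_cases b ∈ T <;> by_cases c ∈ T <;> simp [*]

/-- The inclusion map from functions on pairs to functions on triples. -/
def pairToTriple (α : Type*) [DecidableEq α] [Fintype α] :
    ({P : Finset α // #P = 2} → ℚ) →ₗ[ℚ] ({U : Finset α // #U = 3} → ℚ) where
  toFun g U := ∑ P, if P.1 ⊆ U.1 then g P else 0
  map_add' g h := by
    ext U
    simp only [Pi.add_apply, ← Finset.sum_add_distrib]
    refine Finset.sum_congr rfl fun P _ => ?_
    split_ifs <;> simp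
  map_smul' r g := by ext U; simp [Finset.mul_sum]

/-- The extension by zero of a function on pairs to all sets `{a, b}`. -/
def onPair (g : {P : Finset α // #P = 2} → ℚ) (a b : α) : ℚ :=
  if h : #({a, b} : Finset α) = 2 then g ⟨{a, b}, h⟩ else 0

variable [Fintype α]

theorem pairToTriple_apply (g : {P : Finset α // #P = 2} → ℚ) {a b c : α} (hab : a ≠ b)
    (hac : a ≠ c) (hbc : b ≠ c) :
    pairToTriple α g ⟨{a, b, c}, Finset.card_eq_three.2 ⟨a, b, c, hab, hac, hbc, rfl⟩⟩ =
      onPair g a b + onPair g a c + onPair g b c := by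
  have n₁ : ({a, b} : Finset α) ≠ {a, c} := fun h => by
    have : b ∈ ({a, c} : Finset α) := h ▸ by simp
    simp [hab.symm, hbc] at this
  have n₂ : ({a, b} : Finset α) ≠ {b, c} := fun h => by
    have : a ∈ ({b, c} : Finset α) := h ▸ by simp
    simp [hab, hac] at this
  have n₃ : ({a, c} : Finset α) ≠ {b, c} := fun h => by
    have : a ∈ ({b, c} : Finset α) := h ▸ by simp
    simp [hab, hac] at this
  have e1 : ∑ P : {P : Finset α // #P = 2}, (if P.1 ⊆ {a, b, c} then g P else 0) =
      ∑ P ∈ powersetCard 2 ({a, b, c} : Finset α), if h : #P = 2 then g ⟨P, h⟩ else 0 := by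
    rw [← Finset.sum_filter]
    refine Finset.sum_bij (fun P _ => P.1) ?_ ?_ ?_ ?_
    · intro P hP
      exact Finset.mem_powersetCard.2 ⟨(Finset.mem_filter.1 hP).2, P.2⟩
    · intro P _ Q _ h
      exact Subtype.ext h
    · intro P hP
      obtain ⟨h1, h2⟩ := Finset.mem_powersetCard.1 hP
      exact ⟨⟨P, h2⟩, by simpa using h1, rfl⟩
    · intro P _
      simp [P.2]
  have e2 : powersetCard 2 ({a, b, c} : Finset α) = {{a, b}, {a, c}, {b, c}} := by
    symm
    apply Finset.eq_of_subset_of_card_le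
    · intro P hP
      simp only [Finset.mem_insert, Finset.mem_singleton] at hP
      rw [Finset.mem_powersetCard]
      obtain rfl | rfl | rfl := hP
      · exact ⟨by intro x; simp; tauto, Finset.card_pair hab⟩
      · exact ⟨by intro x; simp; tauto, Finset.card_pair hac⟩
      · exact ⟨by intro x; simp; tauto, Finset.card_pair hbc⟩
    · rw [Finset.card_powersetCard, Finset.card_eq_three.2 ⟨a, b, c, hab, hac, hbc, rfl⟩]
      rw [show #({{a, b}, {a, c}, {b, c}} : Finset (Finset α)) = 3 from
        Finset.card_eq_three.2 ⟨_, _, _, n₁, n₂, n₃, rfl⟩]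
      decide
  change ∑ P : {P : Finset α // #P = 2}, (if P.1 ⊆ {a, b, c} then g P else 0) = _
  rw [e1, e2, Finset.sum_insert, Finset.sum_insert, Finset.sum_singleton, ← add_assoc]
  · rfl
  · simpa using n₃
  · simpa using ⟨n₁, n₂⟩

/-- A function on pairs that sums to zero over each triple takes the same value on disjoint pairs,
hence, in the presence of a fifth point, on the three pairs of a triple. -/
theorem pairToTriple_injective (hn : 5 ≤ Fintype.card α) :
    Function.Injective (pairToTriple α) := by
  rw [← LinearMap.ker_eq_bot, LinearMap.ker_eq_bot']
  intro g hg
  have htri : ∀ a b c : α, a ≠ b → a ≠ c → b ≠ c →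
      onPair g a b + onPair g a c + onPair g b c = 0 := fun a b c hab hac hbc => by
    rw [← pairToTriple_apply g hab hac hbc, hg]; rfl
  have hdisj : ∀ a b c d : α, a ≠ b → a ≠ c → a ≠ d → b ≠ c → b ≠ d → c ≠ d →
      onPair g a b = onPair g c d := by
    intro a b c d hab hac had hbc hbd hcd
    linarith [htri a b c hab hac hbc, htri a b d hab had hbd, htri a c d hac had hcd,
      htri b c d hbc hbd hcd]
  ext ⟨P, hP⟩
  obtain ⟨a, b, hab, rfl⟩ := Finset.card_eq_two.1 hP
  have h3 : 3 ≤ #({a, b} : Finset α)ᶜ := by rw [Finset.card_compl, hP]; omega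
  obtain ⟨U, hU, hU3⟩ := Finset.exists_subset_card_eq h3
  obtain ⟨c, d, e, hcd, hce, hde, rfl⟩ := Finset.card_eq_three.1 hU3
  have hc := hU (show c ∈ _ by simp)
  have hd := hU (show d ∈ _ by simp)
  have he := hU (show e ∈ _ by simp)
  simp only [Finset.mem_compl, Finset.mem_insert, Finset.mem_singleton, not_or] at hc hd he
  have h1 := hdisj a b c d hab (Ne.symm hc.1) (Ne.symm hd.1) (Ne.symm hc.2) (Ne.symm hd.2) hcd
  have h2 := hdisj a e c d (Ne.symm he.1) (Ne.symm hc.1) (Ne.symm hd.1) hce.symm hde.symm hcd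
  have h4 := hdisj b e c d (Ne.symm he.2) (Ne.symm hc.2) (Ne.symm hd.2) hce.symm hde.symm hcd
  have h5 := htri a b e hab (Ne.symm he.1) (Ne.symm he.2)
  have h6 : onPair g a b = 0 := by linarith
  simpa [onPair, hP] using h6

theorem finrank_triple_quotient (hn : 5 ≤ Fintype.card α) :
    Module.finrank ℚ (({U : Finset α // #U = 3} → ℚ) ⧸ LinearMap.range (pairToTriple α)) =
      (Fintype.card α).choose 3 - (Fintype.card α).choose 2 := by
  have h1 := LinearMap.finrank_range_of_inj (pairToTriple_injective hn)
  have h2 := Submodule.finrank_quotient_add_finrank (LinearMap.range (pairToTriple α))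
  rw [h1, Module.finrank_fintype_fun_eq_card, Module.finrank_fintype_fun_eq_card,
    Fintype.card_finset_len, Fintype.card_finset_len] at h2
  omega

/-- If the sums of a weighting over the sets through each triple come from a function on pairs, then
the weighting is orthogonal to the degree-three zonal kernel. -/
theorem sum_mul_pairKernel_three_eq_zero (X : Finset (Finset α)) (c : Finset α → ℚ)
    (g : {P : Finset α // #P = 2} → ℚ)
    (hc : ∀ U : {U : Finset α // #U = 3},
      ∑ T ∈ X, c T * (if U.1 ⊆ T then 1 else 0) = pairToTriple α g U) (S : Finset α) :
    ∑ T ∈ X, c T * pairKernel S T 3 univ = 0 := by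
  have htri : ∀ a b d : α, a ≠ b → a ≠ d → b ≠ d →
      ∑ T ∈ X, c T * ((if a ∈ T then 1 else 0) * (if b ∈ T then 1 else 0) *
        (if d ∈ T then 1 else 0)) = onPair g a b + onPair g a d + onPair g b d := by
    intro a b d hab had hbd
    rw [← pairToTriple_apply g hab had hbd, ← hc]
    simp only [indicator_triple]
  -- each product of three differences is an alternating sum over eight triples, in which every
  -- pair occurs twice with opposite signs
  have hpsi : ∀ a₁ b₁ : α, ∀ a₂ ∈ (univ.erase a₁).erase b₁, ∀ b₂ ∈ (univ.erase a₁).erase b₁,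
      ∀ a₃ ∈ (((univ.erase a₁).erase b₁).erase a₂).erase b₂,
      ∀ b₃ ∈ (((univ.erase a₁).erase b₁).erase a₂).erase b₂,
      ∑ T ∈ X, c T * (indicatorDiff T a₁ b₁ * indicatorDiff T a₂ b₂ * indicatorDiff T a₃ b₃) =
        0 := by
    intro a₁ b₁ a₂ ha₂ b₂ hb₂ a₃ ha₃ b₃ hb₃
    simp only [Finset.mem_erase, Finset.mem_univ, and_true] at ha₂ hb₂ ha₃ hb₃
    have h (x y z : α) (hx : x = a₁ ∨ x = b₁) (hy : y = a₂ ∨ y = b₂) (hz : z = a₃ ∨ z = b₃) :=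
      htri x y z (by grind) (by grind) (by grind)
    have e : ∀ T ∈ X,
        c T * (indicatorDiff T a₁ b₁ * indicatorDiff T a₂ b₂ * indicatorDiff T a₃ b₃) =
        c T * ((if a₁ ∈ T then 1 else 0) * (if a₂ ∈ T then 1 else 0) * (if a₃ ∈ T then 1 else 0)) -
        c T * ((if a₁ ∈ T then 1 else 0) * (if a₂ ∈ T then 1 else 0) * (if b₃ ∈ T then 1 else 0)) -
        c T * ((if a₁ ∈ T then 1 else 0) * (if b₂ ∈ T then 1 else 0) * (if a₃ ∈ T then 1 else 0)) +
        c T * ((if a₁ ∈ T then 1 else 0) * (if b₂ ∈ T then 1 else 0) * (if b₃ ∈ T then 1 else 0)) -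
        c T * ((if b₁ ∈ T then 1 else 0) * (if a₂ ∈ T then 1 else 0) * (if a₃ ∈ T then 1 else 0)) +
        c T * ((if b₁ ∈ T then 1 else 0) * (if a₂ ∈ T then 1 else 0) * (if b₃ ∈ T then 1 else 0)) +
        c T * ((if b₁ ∈ T then 1 else 0) * (if b₂ ∈ T then 1 else 0) * (if a₃ ∈ T then 1 else 0)) -
        c T * ((if b₁ ∈ T then 1 else 0) * (if b₂ ∈ T then 1 else 0) *
          (if b₃ ∈ T then 1 else 0)) := by
      intro T _
      unfold indicatorDiff
      ring
    rw [Finset.sum_congr rfl e]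
    simp only [Finset.sum_add_distrib, Finset.sum_sub_distrib]
    rw [h a₁ a₂ a₃ (.inl rfl) (.inl rfl) (.inl rfl), h a₁ a₂ b₃ (.inl rfl) (.inl rfl) (.inr rfl),
      h a₁ b₂ a₃ (.inl rfl) (.inr rfl) (.inl rfl), h a₁ b₂ b₃ (.inl rfl) (.inr rfl) (.inr rfl),
      h b₁ a₂ a₃ (.inr rfl) (.inl rfl) (.inl rfl), h b₁ a₂ b₃ (.inr rfl) (.inl rfl) (.inr rfl),
      h b₁ b₂ a₃ (.inr rfl) (.inr rfl) (.inl rfl), h b₁ b₂ b₃ (.inr rfl) (.inr rfl) (.inr rfl)]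
    ring
  simp only [pairKernel, Finset.mul_sum, mul_one]
  rw [Finset.sum_comm]
  refine Finset.sum_eq_zero fun a₁ _ => ?_
  rw [Finset.sum_comm]
  refine Finset.sum_eq_zero fun b₁ _ => ?_
  rw [Finset.sum_comm]
  refine Finset.sum_eq_zero fun a₂ ha₂ => ?_
  rw [Finset.sum_comm]
  refine Finset.sum_eq_zero fun b₂ hb₂ => ?_
  rw [Finset.sum_comm]
  refine Finset.sum_eq_zero fun a₃ ha₃ => ?_
  rw [Finset.sum_comm]
  refine Finset.sum_eq_zero fun b₃ hb₃ => ?_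
  have := hpsi a₁ b₁ a₂ ha₂ b₂ hb₂ a₃ ha₃ b₃ hb₃
  calc _ = (indicatorDiff S a₁ b₁ * indicatorDiff S a₂ b₂ * indicatorDiff S a₃ b₃) *
        ∑ T ∈ X, c T *
          (indicatorDiff T a₁ b₁ * indicatorDiff T a₂ b₂ * indicatorDiff T a₃ b₃) := by
          rw [Finset.mul_sum]
          refine Finset.sum_congr rfl fun T _ => ?_
          ring
    _ = 0 := by rw [this, mul_zero]

end CubicDefect

/-! ### Zonal expansion of a cubic -/

section Annihilator

theorem cast_descFactorial_three (a : ℕ) :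
    ((a.descFactorial 3 : ℕ) : ℚ) = a * (a - 1) * (a - 2) := by
  obtain _ | _ | a := a
  · simp
  · simp
  · rw [Nat.descFactorial_succ, Nat.cast_mul, Nat.cast_descFactorial_two,
      show a + 1 + 1 - 2 = a from rfl]
    push_cast
    ring

theorem cast_hahn_one {n w t : ℕ} (ht : t ≤ w) (hn : w + t ≤ n) :
    (hahn n w 1 t : ℚ) = (w - t) * (n - w - t) - t ^ 2 := by
  simp [hahn, dualHahn, Finset.Nat.antidiagonal_succ, Nat.sub_sub, Nat.cast_sub ht,
    Nat.cast_sub hn]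
  ring

theorem cast_hahn_two {n w t : ℕ} (ht : t ≤ w) (hn : w + t ≤ n) :
    (hahn n w 2 t : ℚ) = (w - t) * (w - t - 1) * ((n - w - t) * (n - w - t - 1)) -
      2 * t ^ 2 * ((w - t) * (n - w - t)) + t ^ 2 * (t - 1) ^ 2 := by
  simp [-Nat.descFactorial_succ, hahn, dualHahn, Finset.Nat.antidiagonal_succ, Nat.sub_sub,
    Nat.cast_sub ht, Nat.cast_sub hn, Nat.cast_descFactorial_two, Nat.descFactorial_one]
  ring

theorem cast_hahn_three {n w t : ℕ} (ht : t ≤ w) (hn : w + t ≤ n) :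
    (hahn n w 3 t : ℚ) =
      (w - t) * (w - t - 1) * (w - t - 2) * ((n - w - t) * (n - w - t - 1) * (n - w - t - 2)) -
      3 * t ^ 2 * ((w - t) * (w - t - 1) * ((n - w - t) * (n - w - t - 1))) +
      3 * t ^ 2 * (t - 1) ^ 2 * ((w - t) * (n - w - t)) -
      t ^ 2 * (t - 1) ^ 2 * (t - 2) ^ 2 := by
  simp [-Nat.descFactorial_succ, hahn, dualHahn, Finset.Nat.antidiagonal_succ, Nat.sub_sub,
    Nat.cast_sub ht, Nat.cast_sub hn, Nat.cast_descFactorial_two, cast_descFactorial_three, Nat.descFactorial_one]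
  ring

/-- Up to the positive factor `n (n - 1) (n - 2)`, the constant coefficient in the zonal expansion
of the cubic with elementary symmetric functions `s₁`, `s₂`, `s₃` of its roots. -/
def zonalCoeffZero (n w s₁ s₂ s₃ : ℤ) : ℤ :=
  s₃ * n * (n - 1) * (n - 2) - (s₂ - s₁ + 1) * (w * (n - w)) * ((n - 1) * (n - 2)) +
    (s₁ - 3) * (w * (w - 1) * (n - w) * (n - w - 1)) * (n - 2) -
    w * (w - 1) * (w - 2) * (n - w) * (n - w - 1) * (n - w - 2)

/-- Up to the positive factor `n (n - 2) (n - 3)`, the coefficient of `hahn n w 1` in the zonal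
expansion of the cubic with elementary symmetric functions `s₁`, `s₂`, `s₃` of its roots. -/
def zonalCoeffOne (n w s₁ s₂ : ℤ) : ℤ :=
  (s₂ - s₁ + 1) * ((n - 2) * (n - 3)) - 2 * (s₁ - 3) * ((w - 1) * (n - w - 1)) * (n - 3) +
    3 * ((w - 1) * (w - 2) * (n - w - 1) * (n - w - 2))

/-- Up to the positive factor `(n - 1) (n - 2) (n - 4)`, the coefficient of `hahn n w 2` in the
zonal expansion of a cubic whose roots have sum `s₁`. -/
def zonalCoeffTwo (n w s₁ : ℤ) : ℤ := (s₁ - 3) * (n - 4) - 3 * ((w - 2) * (n - w - 2))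

theorem zonal_expansion {n w t : ℕ} (ht : t ≤ w) (hn : w + t ≤ n) (h5 : 5 ≤ n) (d e f : ℕ) :
    ((d : ℚ) - t) * (e - t) * (f - t) =
      (zonalCoeffZero n w (d + e + f) (d * e + d * f + e * f) (d * e * f) : ℤ) /
          (n * (n - 1) * (n - 2)) +
        ((zonalCoeffOne n w (d + e + f) (d * e + d * f + e * f) : ℤ) / (n * (n - 2) * (n - 3)) *
            hahn n w 1 t +
          (zonalCoeffTwo n w (d + e + f) : ℤ) / ((n - 1) * (n - 2) * (n - 4)) * hahn n w 2 t +
          1 / ((n - 2) * (n - 3) * (n - 4)) * hahn n w 3 t) := by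
  have h : (5 : ℚ) ≤ n := by exact_mod_cast h5
  have h0 : (n : ℚ) ≠ 0 := by linarith
  have h1 : (n : ℚ) - 1 ≠ 0 := by linarith
  have h2 : (n : ℚ) - 2 ≠ 0 := by linarith
  have h3 : (n : ℚ) - 3 ≠ 0 := by linarith
  have h4 : (n : ℚ) - 4 ≠ 0 := by linarith
  rw [cast_hahn_one ht hn, cast_hahn_two ht hn, cast_hahn_three ht hn, zonalCoeffZero,
    zonalCoeffOne, zonalCoeffTwo]
  push_cast
  field_simp
  ring

end Annihilator

/-! ### The annihilator bound and the harmonic bound -/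

section Bounds

variable {α : Type*} [DecidableEq α] [Fintype α]

theorem card_sdiff_bounds {X : Finset (Finset α)} {n w : ℕ} (hn : Fintype.card α = n)
    (hX : ∀ S ∈ X, #S = w) {S T : Finset α} (hS : S ∈ X) (hT : T ∈ X) :
    #(S \ T) ≤ w ∧ w + #(S \ T) ≤ n := by
  have h1 := Finset.card_le_card (Finset.sdiff_subset (s := S) (t := T))
  have h2 := Finset.card_sdiff_add_card S T
  have h3 := Finset.card_le_univ (S ∪ T)
  have := hX S hS
  have := hX T hT
  omega

/-- The linear programming bound with the annihilator polynomial of the three distances as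
certificate. -/
theorem zonalCoeffZero_mul_card_le {X : Finset (Finset α)} {n w : ℕ} (hn : Fintype.card α = n)
    (hX : ∀ S ∈ X, #S = w) (hne : X.Nonempty) (h5 : 5 ≤ n) {d e f : ℕ}
    (hd : ∀ S ∈ X, ∀ T ∈ X, S ≠ T → #(S \ T) = d ∨ #(S \ T) = e ∨ #(S \ T) = f)
    (h1 : 0 ≤ zonalCoeffOne n w (d + e + f) (d * e + d * f + e * f))
    (h2 : 0 ≤ zonalCoeffTwo n w (d + e + f)) :
    zonalCoeffZero n w (d + e + f) (d * e + d * f + e * f) (d * e * f) * #X ≤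
      d * e * f * (n * (n - 1) * (n - 2)) := by
  have h : (5 : ℚ) ≤ n := by exact_mod_cast h5
  have p0 : (0 : ℚ) < n := by linarith
  have p1 : (0 : ℚ) < n - 1 := by linarith
  have p2 : (0 : ℚ) < n - 2 := by linarith
  have p3 : (0 : ℚ) < n - 3 := by linarith
  have p4 : (0 : ℚ) < n - 4 := by linarith
  obtain ⟨S₀, hS₀⟩ := hne
  have hb := (card_sdiff_bounds hn hX hS₀ hS₀)
  rw [Finset.sdiff_self, Finset.card_empty] at hb
  have key := linear_programming_bound hn hX ⟨S₀, hS₀⟩ ![1, 2, 3]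
    ((zonalCoeffZero n w (d + e + f) (d * e + d * f + e * f) (d * e * f) : ℤ) /
      (n * (n - 1) * (n - 2)))
    ![(zonalCoeffOne n w (d + e + f) (d * e + d * f + e * f) : ℤ) / (n * (n - 2) * (n - 3)),
      (zonalCoeffTwo n w (d + e + f) : ℤ) / ((n - 1) * (n - 2) * (n - 4)),
      1 / ((n - 2) * (n - 3) * (n - 4))]
    (by intro i; fin_cases i <;> simp <;> positivity)
    (by
      intro S hS T hT hST
      obtain ⟨hb1, hb2⟩ := card_sdiff_bounds hn hX hS hT
      have hz := zonal_expansion hb1 hb2 h5 d e f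
      simp only [Fin.sum_univ_three, Matrix.cons_val_zero, Matrix.cons_val_one,
        Matrix.cons_val]
      rw [← hz]
      obtain h | h | h := hd S hS T hT hST <;> simp [h])
  have hz := zonal_expansion hb.1 hb.2 h5 d e f
  simp only [Fin.sum_univ_three, Matrix.cons_val_zero, Matrix.cons_val_one,
    Matrix.cons_val] at key
  rw [← hz, div_mul_eq_mul_div, div_le_iff₀ (by positivity)] at key
  have key' : ((zonalCoeffZero n w (d + e + f) (d * e + d * f + e * f) (d * e * f) : ℤ) : ℚ) * #X ≤
      d * e * f * (n * (n - 1) * (n - 2)) := by simpa using key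
  exact_mod_cast key'

/-- The harmonic bound: if the coefficient of degree two in the zonal expansion of the annihilator
polynomial is not positive, then the family is no larger than the joint dimension of the zonal
spaces of degrees zero, one and three. -/
theorem card_le_of_zonalCoeffTwo_nonpos {X : Finset (Finset α)} {n w : ℕ}
    (hn : Fintype.card α = n) (hw : 1 ≤ w) (hX : ∀ S ∈ X, #S = w) (h5 : 5 ≤ n) {d e f : ℕ}
    (hd0 : 0 < d) (he0 : 0 < e) (hf0 : 0 < f)
    (hd : ∀ S ∈ X, ∀ T ∈ X, S ≠ T → #(S \ T) = d ∨ #(S \ T) = e ∨ #(S \ T) = f)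
    (h2 : zonalCoeffTwo n w (d + e + f) ≤ 0) :
    #X ≤ n.choose 3 - n.choose 2 + n := by
  by_contra! hlt
  have h : (5 : ℚ) ≤ n := by exact_mod_cast h5
  have p1 : (0 : ℚ) < n - 1 := by linarith
  have p2 : (0 : ℚ) < n - 2 := by linarith
  have p4 : (0 : ℚ) < n - 4 := by linarith
  let L₁ : (Finset α → ℚ) →ₗ[ℚ] ({U : Finset α // #U = 3} → ℚ) :=
    { toFun := fun c U => ∑ T ∈ X, c T * (if U.1 ⊆ T then 1 else 0)
      map_add' := fun c c' => by
        ext P; simp only [Pi.add_apply, add_mul, Finset.sum_add_distrib]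
      map_smul' := fun r c => by ext P; simp [Finset.mul_sum] }
  let L₂ : (Finset α → ℚ) →ₗ[ℚ] (α → ℚ) :=
    { toFun := fun c a => ∑ T ∈ X, c T * (if a ∈ T then 1 else 0)
      map_add' := fun c c' => by
        ext P; simp only [Pi.add_apply, add_mul, Finset.sum_add_distrib]
      map_smul' := fun r c => by ext P; simp [Finset.mul_sum] }
  obtain ⟨c, ⟨S₀, hS₀, hcS⟩, -, hLc⟩ := exists_mem_ne_zero_of_finrank_lt_card X
    (((LinearMap.range (pairToTriple α)).mkQ ∘ₗ L₁).prod L₂) (by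
      rwa [Module.finrank_prod, finrank_triple_quotient (by omega),
        Module.finrank_fintype_fun_eq_card, hn])
  obtain ⟨hc3, hc1⟩ := Prod.mk.inj hLc
  obtain ⟨g, hg⟩ := (Submodule.Quotient.mk_eq_zero _).1 hc3
  have hpt : ∀ a, ∑ T ∈ X, c T * (if a ∈ T then 1 else 0) = 0 := fun a => congrFun hc1 a
  have hone := sum_eq_zero_of_point_sums hw hX hpt
  have hthree : ∀ S ∈ X, ∑ T ∈ X, c T * (hahn n w 3 #(S \ T) : ℚ) = 0 := by
    intro S hS
    have h0 := sum_mul_pairKernel_three_eq_zero X c g (fun U => (congrFun hg U).symm) S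
    rw [Finset.sum_congr rfl fun T hT => by rw [pairKernel_univ hn (hX S hS) (hX T hT) 3]] at h0
    simp only [mul_left_comm _ ((2 : ℚ) ^ 3), ← Finset.mul_sum] at h0
    exact (mul_eq_zero.1 h0).resolve_left (by norm_num)
  have hlin : ∀ S ∈ X, ∑ T ∈ X, c T * (hahn n w 1 #(S \ T) : ℚ) = 0 := by
    intro S hS
    have h0 := sum_mul_card_inter_eq_zero hpt S
    have e1 : ∀ T ∈ X, c T * (hahn n w 1 #(S \ T) : ℚ) =
        n * (c T * (#(S ∩ T) : ℚ)) - w ^ 2 * c T := by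
      intro T hT
      obtain ⟨hb1, hb2⟩ := card_sdiff_bounds hn hX hS hT
      have h1 := Finset.card_sdiff_add_card_inter S T
      rw [hX S hS] at h1
      have h2 : (#(S \ T) : ℚ) = w - #(S ∩ T) := by rw [← h1]; push_cast; ring
      rw [cast_hahn_one hb1 hb2, h2]
      ring
    rw [Finset.sum_congr rfl e1, Finset.sum_sub_distrib, ← Finset.mul_sum, ← Finset.mul_sum, h0,
      hone]
    ring
  -- the quadratic form of the annihilator polynomial on `c`, computed in two ways
  have hdiag : ∑ S ∈ X, ∑ T ∈ X, c S * c T *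
      (((d : ℚ) - #(S \ T)) * (e - #(S \ T)) * (f - #(S \ T))) =
      d * e * f * ∑ S ∈ X, c S ^ 2 := by
    rw [Finset.mul_sum]
    refine Finset.sum_congr rfl fun S hS => ?_
    rw [Finset.sum_eq_single_of_mem S hS]
    · simp; ring
    · intro T hT hTS
      obtain h | h | h := hd S hS T hT hTS.symm <;> simp [h]
  have hzon : ∑ S ∈ X, ∑ T ∈ X, c S * c T *
      (((d : ℚ) - #(S \ T)) * (e - #(S \ T)) * (f - #(S \ T))) =
      (zonalCoeffTwo n w (d + e + f) : ℤ) / ((n - 1) * (n - 2) * (n - 4)) *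
        ∑ S ∈ X, ∑ T ∈ X, c S * c T * (hahn n w 2 #(S \ T) : ℚ) := by
    rw [Finset.mul_sum]
    refine Finset.sum_congr rfl fun S hS => ?_
    set l₀ : ℚ := (zonalCoeffZero n w (d + e + f) (d * e + d * f + e * f) (d * e * f) : ℤ) /
      (n * (n - 1) * (n - 2))
    set l₁ : ℚ := (zonalCoeffOne n w (d + e + f) (d * e + d * f + e * f) : ℤ) /
      (n * (n - 2) * (n - 3))
    set l₂ : ℚ := (zonalCoeffTwo n w (d + e + f) : ℤ) / ((n - 1) * (n - 2) * (n - 4))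
    set l₃ : ℚ := 1 / (((n : ℚ) - 2) * (n - 3) * (n - 4))
    have e1 : ∀ T ∈ X, c S * c T * (((d : ℚ) - #(S \ T)) * (e - #(S \ T)) * (f - #(S \ T))) =
        l₂ * (c S * c T * (hahn n w 2 #(S \ T) : ℚ)) + c S * l₀ * c T +
          c S * l₁ * (c T * (hahn n w 1 #(S \ T) : ℚ)) +
          c S * l₃ * (c T * (hahn n w 3 #(S \ T) : ℚ)) := by
      intro T hT
      obtain ⟨hb1, hb2⟩ := card_sdiff_bounds hn hX hS hT
      rw [zonal_expansion hb1 hb2 h5 d e f]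
      ring
    rw [Finset.sum_congr rfl e1]
    simp only [Finset.sum_add_distrib, ← Finset.mul_sum, hone, hlin S hS, hthree S hS]
    ring
  have hle : (d : ℚ) * e * f * ∑ S ∈ X, c S ^ 2 ≤ 0 := by
    rw [← hdiag, hzon]
    exact mul_nonpos_of_nonpos_of_nonneg (div_nonpos_of_nonpos_of_nonneg
      (by exact_mod_cast h2) (by positivity))
      (sum_hahn_nonneg hn hX 2 c)
  have hpos : 0 < ∑ S ∈ X, c S ^ 2 :=
    Finset.sum_pos' (fun S _ => sq_nonneg _) ⟨S₀, hS₀, by positivity⟩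
  have : (0 : ℚ) < d * e * f * ∑ S ∈ X, c S ^ 2 := by positivity
  linarith

end Bounds

/-! ### Decidable linear programming certificates -/

section Certificates

/-- The alternating sum of the `l` values of `g` that start at `s`. -/
def altSum (g : ℕ → ℕ) : ℕ → ℕ → ℤ
  | _, 0 => 0
  | s, l + 1 => g s - altSum g (s + 1) l

theorem altSum_eq (g : ℕ → ℕ) (s l : ℕ) :
    altSum g s l = ∑ j ∈ range l, (-1) ^ j * (g (s + j) : ℤ) := by
  induction l generalizing s with
  | zero => rfl
  | succ l ih =>
    rw [Finset.sum_range_succ', altSum, ih, sub_eq_add_neg, ← Finset.sum_neg_distrib, add_comm]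
    congr 1
    · refine Finset.sum_congr rfl fun j _ => ?_
      rw [pow_succ, show s + 1 + j = s + (j + 1) by ring]
      ring
    · simp

/-- The value `hahn n w k t` in a form that the kernel evaluates quickly: recursions that branch and
powers in monoids are avoided. -/
def hahnEval (n w k t : ℕ) : ℤ :=
  altSum (fun j => k.descFactorial j / j.factorial * (t.descFactorial j * t.descFactorial j) *
    ((w - t).descFactorial (k - j) * (n - w - t).descFactorial (k - j))) 0 (k + 1)

theorem hahnEval_eq (n w k t : ℕ) : hahnEval n w k t = hahn n w k t := by
  rw [hahnEval, altSum_eq, hahn, dualHahn,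
    Finset.Nat.sum_antidiagonal_eq_sum_range_succ (fun a b : ℕ =>
      (k.choose a : ℤ) * ((-1) ^ a * ((t.descFactorial a * t.descFactorial a : ℕ) : ℤ) *
      (((w - t).descFactorial b * (n - w - t).descFactorial b : ℕ) : ℤ)))]
  refine Finset.sum_congr rfl fun j _ => ?_
  rw [Nat.zero_add, ← Nat.choose_eq_descFactorial_div_factorial]
  push_cast
  ring

theorem hahn_zero_right (n w k : ℕ) :
    hahn n w k 0 = ((w.descFactorial k * (n - w).descFactorial k : ℕ) : ℤ) := by
  rw [hahn, dualHahn, Finset.sum_eq_single_of_mem (0, k) (by simp)]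
  · simp
  · rintro ⟨a, b⟩ hab h
    have ha : a ≠ 0 := by
      rintro rfl
      exact h (by simpa using hab)
    simp [Nat.descFactorial_eq_zero_iff_lt.2 (Nat.pos_of_ne_zero ha)]

/-- The coefficients `D, x, y, z` are admissible in the linear programming bound, and with
`q, r, s` the values at zero of the three zonal functions, the bound that they give is at most
`B`. -/
def IsCertificate (D x y z q r s B : ℤ) : Prop :=
  0 < D ∧ 0 ≤ x ∧ 0 ≤ y ∧ 0 ≤ z ∧ x * q + y * r + z * s < D * B

instance (D x y z q r s B : ℤ) : Decidable (IsCertificate D x y z q r s B) :=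
  inferInstanceAs (Decidable (_ ∧ _ ∧ _ ∧ _ ∧ _))

/-- The test of the linear combination of `1` and three zonal functions that vanishes at three
given points. Its coefficients form the cross product of two differences of the vectors
`(a, b, c)`, `(a', b', c')`, `(a'', b'', c'')` of values there, up to a common sign. -/
def crossTest (a b c a' b' c' a'' b'' c'' q r s B : ℤ) : Bool :=
  let x := (b' - b) * (c'' - c) - (c' - c) * (b'' - b)
  let y := (c' - c) * (a'' - a) - (a' - a) * (c'' - c)
  let z := (a' - a) * (b'' - b) - (b' - b) * (a'' - a)
  let D := -(x * a + y * b + z * c)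
  decide (IsCertificate D x y z q r s B) || decide (IsCertificate (-D) (-x) (-y) (-z) q r s B)

/-- The certificate test for the distances `d, e, f` and the zonal functions of the three degrees in
`K`. -/
def zonalTest (n w d e f B : ℕ) (K : ℕ × ℕ × ℕ) : Bool :=
  let h := hahnEval n w
  let h₀ (k : ℕ) : ℤ := (w.descFactorial k * (n - w).descFactorial k : ℕ)
  crossTest (h K.1 d) (h K.2.1 d) (h K.2.2 d) (h K.1 e) (h K.2.1 e) (h K.2.2 e)
    (h K.1 f) (h K.2.1 f) (h K.2.2 f) (h₀ K.1) (h₀ K.2.1) (h₀ K.2.2) B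

/-- The test of the Plotkin bound for families with minimum distance `d`. -/
def plotkinTest (n w d B : ℕ) : Bool :=
  w * (n - w) < n * d && n * d < (n * d - w * (n - w)) * (B + 1)

/-- The test of the linear programming bound with the annihilator polynomial. -/
def annihilatorTest (n w d e f : ℕ) (B : ℤ) : Bool :=
  0 ≤ zonalCoeffOne n w (d + e + f) (d * e + d * f + e * f) &&
  0 ≤ zonalCoeffTwo n w (d + e + f) &&
  (d * e * f * (n * (n - 1) * (n - 2)) : ℤ) <
    zonalCoeffZero n w (d + e + f) (d * e + d * f + e * f) (d * e * f) * (B + 1)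

/-- One of the linear programming bounds, with the degrees of the general certificate taken from the
list `Ks`, shows that a family with distances `d < e < f` has at most `B` members. -/
def lpTest (n w d e f B : ℕ) (Ks : List (ℕ × ℕ × ℕ)) : Bool :=
  plotkinTest n w d B || annihilatorTest n w d e f B || Ks.any (zonalTest n w d e f B)

variable {α : Type*} [DecidableEq α] [Fintype α] {X : Finset (Finset α)} {n w d e f B : ℕ}

theorem card_le_of_isCertificate (hn : Fintype.card α = n) (hX : ∀ S ∈ X, #S = w)
    (hne : X.Nonempty)
    (hd : ∀ S ∈ X, ∀ T ∈ X, S ≠ T → #(S \ T) = d ∨ #(S \ T) = e ∨ #(S \ T) = f)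
    {k₁ k₂ k₃ : ℕ} {D x y z : ℤ}
    (hvan : ∀ t, t = d ∨ t = e ∨ t = f →
      D + (x * hahn n w k₁ t + y * hahn n w k₂ t + z * hahn n w k₃ t) = 0)
    (h : IsCertificate D x y z (hahn n w k₁ 0) (hahn n w k₂ 0) (hahn n w k₃ 0) B) : #X ≤ B := by
  obtain ⟨hD, hx, hy, hz, hB⟩ := h
  have key := linear_programming_bound hn hX hne ![k₁, k₂, k₃] D ![(x : ℚ), y, z]
    (by intro i; fin_cases i <;> simpa)
    (by
      intro S hS T hT hST
      simp only [Fin.sum_univ_three, Matrix.cons_val_zero, Matrix.cons_val_one, Matrix.cons_val]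
      exact_mod_cast (hvan _ (hd S hS T hT hST)).le)
  simp only [Fin.sum_univ_three, Matrix.cons_val_zero, Matrix.cons_val_one, Matrix.cons_val] at key
  have key' : D * #X ≤ D + (x * hahn n w k₁ 0 + y * hahn n w k₂ 0 + z * hahn n w k₃ 0) := by
    exact_mod_cast key
  have h1 : D * (#X : ℤ) < D * (B + 1) := by linarith
  have h2 : (#X : ℤ) < B + 1 := lt_of_mul_lt_mul_left h1 hD.le
  omega

theorem card_le_of_zonalTest (hn : Fintype.card α = n) (hX : ∀ S ∈ X, #S = w)
    (hne : X.Nonempty)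
    (hd : ∀ S ∈ X, ∀ T ∈ X, S ≠ T → #(S \ T) = d ∨ #(S \ T) = e ∨ #(S \ T) = f)
    {K : ℕ × ℕ × ℕ} (h : zonalTest n w d e f B K = true) : #X ≤ B := by
  simp only [zonalTest, crossTest, hahnEval_eq, ← hahn_zero_right, Bool.or_eq_true,
    decide_eq_true_eq] at h
  obtain h | h := h
  · refine card_le_of_isCertificate hn hX hne hd ?_ h
    rintro t (rfl | rfl | rfl) <;> ring
  · refine card_le_of_isCertificate hn hX hne hd ?_ h
    rintro t (rfl | rfl | rfl) <;> ring

theorem card_le_of_plotkinTest (hn : Fintype.card α = n) (hX : ∀ S ∈ X, #S = w)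
    (hne : X.Nonempty) (hde : d ≤ e) (hdf : d ≤ f)
    (hd : ∀ S ∈ X, ∀ T ∈ X, S ≠ T → #(S \ T) = d ∨ #(S \ T) = e ∨ #(S \ T) = f)
    (h : plotkinTest n w d B = true) : #X ≤ B := by
  simp only [plotkinTest, Bool.and_eq_true, decide_eq_true_eq] at h
  obtain ⟨h1, h2⟩ := h
  obtain ⟨S₀, hS₀⟩ := hne
  have hwn : w ≤ n := hX S₀ hS₀ ▸ hn ▸ Finset.card_le_univ S₀
  have key := linear_programming_bound hn hX ⟨S₀, hS₀⟩ ![1, 1, 1]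
    ((n : ℚ) * d - w * (n - w)) ![1, 0, 0] (by intro i; fin_cases i <;> simp)
    (by
      intro S hS T hT hST
      obtain ⟨hb1, hb2⟩ := card_sdiff_bounds hn hX hS hT
      have hle : d ≤ #(S \ T) := by obtain h | h | h := hd S hS T hT hST <;> omega
      have hle' : (n : ℚ) * d ≤ n * #(S \ T) := by exact_mod_cast Nat.mul_le_mul_left n hle
      simp only [Fin.sum_univ_three, Matrix.cons_val_zero, Matrix.cons_val_one, Matrix.cons_val,
        zero_mul, add_zero, one_mul, cast_hahn_one hb1 hb2]
      linarith)
  simp only [Fin.sum_univ_three, Matrix.cons_val_zero, Matrix.cons_val_one, Matrix.cons_val,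
    zero_mul, add_zero, one_mul, cast_hahn_one (Nat.zero_le w) hwn] at key
  obtain ⟨m, rfl⟩ := Nat.exists_eq_add_of_le hwn
  obtain ⟨p, hp⟩ := Nat.exists_eq_add_of_lt h1
  rw [Nat.add_sub_cancel_left] at h1 h2 hp
  have hpq : ((w + m : ℕ) : ℚ) * d = w * m + p + 1 := by exact_mod_cast hp
  have hsub : (w + m) * d - w * m = p + 1 := by omega
  rw [hsub] at h2
  push_cast at key hpq
  have h3 : ((p : ℚ) + 1) * #X ≤ (w + m) * d := by
    calc ((p : ℚ) + 1) * #X = ((w + m) * d - w * (w + m - w)) * #X := by rw [hpq]; ring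
      _ ≤ _ := key
      _ = _ := by ring
  have h4 : (p + 1) * #X ≤ (w + m) * d := by exact_mod_cast h3
  exact Nat.lt_succ_iff.1 (lt_of_mul_lt_mul_left (h4.trans_lt h2) (Nat.zero_le _))

theorem card_le_of_annihilatorTest (hn : Fintype.card α = n) (hX : ∀ S ∈ X, #S = w)
    (hne : X.Nonempty) (h5 : 5 ≤ n)
    (hd : ∀ S ∈ X, ∀ T ∈ X, S ≠ T → #(S \ T) = d ∨ #(S \ T) = e ∨ #(S \ T) = f)
    (h : annihilatorTest n w d e f B = true) : #X ≤ B := by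
  simp only [annihilatorTest, Bool.and_eq_true, decide_eq_true_eq] at h
  obtain ⟨⟨h1, h2⟩, h3⟩ := h
  have key := (zonalCoeffZero_mul_card_le hn hX hne h5 hd h1 h2).trans_lt h3
  have hpos : 0 ≤ zonalCoeffZero n w (d + e + f) (d * e + d * f + e * f) (d * e * f) := by
    by_contra! hneg
    have : (0 : ℤ) ≤ d * e * f * (n * (n - 1) * (n - 2)) := by
      have h5' : (5 : ℤ) ≤ n := by exact_mod_cast h5
      have : (0 : ℤ) ≤ n - 1 := by omega
      have : (0 : ℤ) ≤ n - 2 := by omega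
      positivity
    nlinarith
  have := lt_of_mul_lt_mul_left key hpos
  omega

theorem card_le_of_lpTest (hn : Fintype.card α = n) (hX : ∀ S ∈ X, #S = w) (h5 : 5 ≤ n)
    (hde : d ≤ e) (hdf : d ≤ f)
    (hd : ∀ S ∈ X, ∀ T ∈ X, S ≠ T → #(S \ T) = d ∨ #(S \ T) = e ∨ #(S \ T) = f)
    {Ks : List (ℕ × ℕ × ℕ)} (h : lpTest n w d e f B Ks = true) : #X ≤ B := by
  obtain rfl | hne := X.eq_empty_or_nonempty
  · simp
  simp only [lpTest, Bool.or_eq_true, List.any_eq_true] at h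
  obtain (h | h) | ⟨K, -, h⟩ := h
  · exact card_le_of_plotkinTest hn hX hne hde hdf hd h
  · exact card_le_of_annihilatorTest hn hX hne h5 hd h
  · exact card_le_of_zonalTest hn hX hne hd h

end Certificates

/-! ### Verification of the certificates -/

section Verification

/-- The condition of `dvd_of_choose_two_lt_card` for each of the distances `d < e < f`. -/
def lagrangeIntegral (d e f : ℕ) : Bool :=
  e * f % ((e - d) * (f - d)) == 0 && d * f % ((e - d) * (f - e)) == 0 &&
    d * e % ((f - d) * (f - e)) == 0

/-- The value of `n.choose 3 - n.choose 2 + n`. -/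
def harmonicBound (n : ℕ) : ℕ := n * (n - 1) * (n - 2) / 6 - n * (n - 1) / 2 + n

/-- For each triple of distances, degrees of zonal functions among which those of a certificate for
`harmonicBound` are found, where the simpler certificates fail. -/
def harmonicDegrees : List ((ℕ × ℕ × ℕ) × List (ℕ × ℕ × ℕ)) :=
  [((1, 3, 4), [(1, 2, 4)]), ((2, 3, 4), [(1, 2, 4)]), ((2, 3, 5), [(2, 3, 4)]),
    ((2, 4, 6), [(2, 3, 5), (1, 3, 4), (1, 4, 5), (1, 5, 6)]),
    ((2, 6, 8), [(1, 5, 6), (1, 2, 7), (1, 4, 5)]), ((3, 4, 5), [(1, 2, 6)]),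
    ((3, 4, 7), [(2, 3, 4)]), ((3, 5, 6), [(1, 2, 4), (1, 3, 4), (2, 3, 4)]),
    ((3, 5, 8), [(2, 3, 5), (2, 4, 5)]), ((3, 6, 9), [(2, 5, 6), (1, 4, 5)]),
    ((3, 9, 12), [(1, 4, 8), (1, 6, 7), (1, 2, 8)]), ((4, 5, 6), [(1, 2, 6)]),
    ((4, 5, 9), [(2, 3, 4)]), ((4, 6, 7), [(1, 3, 4), (1, 2, 4), (2, 3, 4)]),
    ((4, 6, 8), [(1, 4, 5), (2, 3, 4), (2, 4, 6), (1, 2, 5)]),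
    ((4, 6, 10), [(2, 3, 4), (2, 3, 9)]), ((4, 8, 12), [(2, 5, 6), (1, 4, 5)]),
    ((4, 9, 10), [(1, 5, 6), (3, 4, 5), (1, 4, 6)]),
    ((4, 12, 16), [(1, 8, 9), (1, 2, 9), (1, 7, 8)]), ((5, 6, 7), [(2, 3, 4)]),
    ((5, 6, 11), [(2, 3, 4), (3, 4, 5)]), ((5, 7, 12), [(2, 3, 4), (3, 4, 5)]),
    ((5, 8, 9), [(1, 4, 5), (1, 3, 4), (2, 3, 4)]),
    ((5, 10, 15), [(1, 5, 6), (5, 6, 7), (1, 2, 6), (1, 4, 5)]),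
    ((5, 15, 20), [(1, 7, 8), (1, 8, 9)]), ((6, 7, 8), [(2, 3, 4)]),
    ((6, 7, 13), [(2, 3, 4), (3, 4, 5)]), ((6, 8, 9), [(2, 3, 4), (1, 2, 4)]),
    ((6, 8, 10), [(1, 2, 4)]), ((6, 8, 12), [(2, 3, 4)]), ((6, 8, 14), [(2, 3, 4), (3, 4, 5)]),
    ((6, 9, 12), [(1, 3, 4), (1, 4, 5), (2, 5, 6), (3, 5, 6)]),
    ((6, 9, 15), [(3, 5, 6), (2, 4, 5), (2, 3, 6), (1, 3, 4)]),
    ((6, 10, 12), [(1, 3, 4), (1, 4, 5), (2, 3, 4)]), ((6, 10, 16), [(2, 5, 6), (1, 4, 5)]),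
    ((6, 12, 18), [(1, 6, 7), (1, 4, 5)]), ((6, 20, 21), [(6, 7, 8)]), ((7, 8, 9), [(2, 3, 4)]),
    ((7, 8, 15), [(2, 3, 4), (3, 4, 5)]), ((7, 9, 10), [(2, 3, 4), (1, 2, 4)]),
    ((7, 9, 16), [(2, 3, 4), (3, 4, 5)]), ((7, 10, 12), [(1, 2, 4), (1, 3, 4), (1, 4, 5)]),
    ((7, 14, 21), [(1, 5, 6)]), ((8, 9, 10), [(2, 3, 4)]), ((8, 9, 17), [(2, 3, 4), (3, 4, 5)]),
    ((8, 10, 12), [(1, 2, 4), (2, 3, 4)]), ((8, 10, 18), [(2, 3, 4), (3, 4, 5)]),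
    ((8, 11, 12), [(3, 4, 5), (2, 3, 4)]),
    ((8, 12, 14), [(1, 3, 4), (1, 2, 4), (2, 3, 4), (1, 4, 5)]),
    ((8, 12, 16), [(1, 3, 4), (1, 4, 5), (2, 3, 4)]), ((8, 12, 20), [(1, 4, 5), (1, 3, 4)]),
    ((8, 14, 15), [(2, 3, 4), (3, 4, 5)]), ((8, 18, 20), [(3, 4, 5)]), ((9, 10, 11), [(2, 3, 4)]),
    ((9, 10, 15), [(2, 3, 4)]), ((9, 10, 19), [(2, 3, 4)]), ((9, 11, 12), [(2, 3, 4)]),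
    ((9, 11, 20), [(2, 3, 4)]), ((9, 12, 13), [(1, 2, 4), (2, 3, 4)]), ((9, 12, 18), [(2, 3, 4)]),
    ((9, 12, 21), [(2, 3, 4)]), ((9, 14, 15), [(2, 3, 4), (1, 3, 4)]), ((9, 15, 18), [(2, 3, 4)]),
    ((10, 11, 21), [(2, 3, 4)]), ((10, 15, 16), [(2, 3, 4)]), ((10, 15, 20), [(2, 3, 4)]),
    ((10, 16, 18), [(2, 3, 4)])]

/-- For each weight and triple of distances, degrees of zonal functions among which those of a
certificate for the size of a star are found, where the simpler certificates fail. -/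
def starDegrees : List ((ℕ × ℕ × ℕ × ℕ) × List (ℕ × ℕ × ℕ)) :=
  [((4, 1, 2, 3), [(2, 3, 4)]), ((4, 1, 3, 4), [(1, 2, 4)]), ((5, 1, 2, 3), [(3, 4, 5)]),
    ((5, 1, 3, 4), [(2, 3, 5), (1, 2, 5)]), ((5, 2, 3, 4), [(2, 3, 4)]),
    ((5, 2, 3, 5), [(1, 3, 4), (2, 3, 4)]), ((6, 1, 2, 3), [(4, 5, 6)]),
    ((6, 1, 3, 4), [(3, 4, 6), (2, 3, 6), (1, 2, 6)]), ((6, 2, 3, 4), [(3, 4, 5), (2, 3, 5)]),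
    ((6, 2, 3, 5), [(2, 4, 5), (1, 3, 4)]), ((6, 2, 4, 6), [(1, 3, 5), (1, 2, 5)]),
    ((6, 3, 4, 5), [(2, 3, 4)]), ((6, 3, 4, 6), [(1, 3, 4)]),
    ((6, 3, 5, 6), [(1, 2, 4), (1, 3, 4)]), ((7, 1, 2, 3), [(5, 6, 7)]),
    ((7, 1, 3, 4), [(3, 4, 7), (4, 5, 7), (2, 3, 7)]), ((7, 2, 3, 4), [(4, 5, 6), (3, 4, 6)]),
    ((7, 2, 3, 5), [(3, 5, 6), (1, 4, 5)]), ((7, 2, 4, 6), [(2, 4, 6)]),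
    ((7, 3, 4, 5), [(3, 4, 5), (2, 3, 5)]), ((7, 3, 4, 6), [(1, 3, 4), (1, 4, 5)]),
    ((7, 3, 4, 7), [(3, 4, 5), (2, 3, 4)]), ((7, 3, 5, 6), [(2, 4, 5), (2, 3, 5)]),
    ((7, 4, 5, 6), [(2, 3, 4)]), ((7, 4, 6, 7), [(1, 3, 4), (1, 2, 4)]),
    ((8, 1, 2, 3), [(6, 7, 8)]), ((8, 1, 3, 4), [(4, 5, 8), (3, 4, 8)]),
    ((8, 2, 3, 4), [(5, 6, 7), (4, 5, 7)]), ((8, 2, 3, 5), [(3, 6, 7), (2, 4, 6)]),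
    ((8, 2, 4, 6), [(2, 5, 7), (2, 4, 7)]), ((8, 2, 6, 8), [(1, 2, 7), (2, 3, 7)]),
    ((8, 3, 4, 5), [(4, 5, 6), (3, 4, 6)]), ((8, 3, 4, 6), [(2, 4, 5), (2, 5, 6)]),
    ((8, 3, 4, 7), [(1, 4, 5), (4, 5, 6), (2, 4, 5)]), ((8, 3, 5, 6), [(3, 5, 6), (2, 3, 5)]),
    ((8, 3, 5, 8), [(1, 3, 6), (1, 5, 6)]), ((8, 4, 5, 6), [(3, 4, 5), (2, 3, 4)]),
    ((8, 4, 6, 7), [(2, 4, 5)]), ((8, 4, 6, 8), [(1, 2, 5), (1, 4, 5), (3, 4, 5)]),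
    ((8, 5, 6, 7), [(2, 3, 4)])]

/-- The test that, at all lengths below `46`, families of `w`-sets with distances `d < e < f` have at
most `harmonicBound` members: the zonal coefficient of degree two is nonpositive, or there is a
linear programming certificate. -/
def harmonicTest (d e f w : ℕ) : Bool :=
  (List.range' (max 11 (2 * w)) (46 - max 11 (2 * w))).all fun n =>
    zonalCoeffTwo n w (d + e + f) ≤ 0 ||
      lpTest n w d e f (harmonicBound n) ((harmonicDegrees.lookup (d, e, f)).getD [])

theorem harmonicTest_eq_true :
    ((List.range 23).all fun f => (List.range f).all fun e => (List.range e).all fun d =>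
      d == 0 || !lagrangeIntegral d e f ||
        (List.range' (max 4 f) (23 - max 4 f)).all (harmonicTest d e f)) = true := by
  decide +kernel

/-- The size of a star: the number of `w`-sets of an `n`-set that contain a given `(w - 3)`-set. -/
def starSize (n w : ℕ) : ℕ := (n - w + 3) * (n - w + 2) * (n - w + 1) / 6

/-- The least length from which on the star is shown to be optimal, for the weights `4` to `8`. -/
def starLength (w : ℕ) : ℕ := [11, 13, 16, 20, 25].getD (w - 4) 0

/-- The test that, at the lengths from `starLength w` to `50`, a linear programming certificate shows
that families of `w`-sets with distances `d < e < f` are no larger than a star. -/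
def starTest (d e f w : ℕ) : Bool :=
  (List.range' (starLength w) (51 - starLength w)).all fun n =>
    lpTest n w d e f (starSize n w) ((starDegrees.lookup (w, d, e, f)).getD [])

theorem starTest_eq_true :
    ((List.range 9).all fun f => (List.range f).all fun e => (List.range e).all fun d =>
      d == 0 || !lagrangeIntegral d e f ||
        (List.range' (max 4 f) (9 - max 4 f)).all (starTest d e f)) = true := by
  decide +kernel

end Verification

/-! ### Families of sets with three distances -/

section Families

variable {α : Type*} [DecidableEq α] [Fintype α] {X : Finset (Finset α)} {n w d e f : ℕ}

theorem lagrangeIntegral_of_choose_two_lt_card (hn : Fintype.card α = n) (hw : 2 ≤ w)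
    (hX : ∀ S ∈ X, #S = w) (hde : d < e) (hef : e < f)
    (hd : ∀ S ∈ X, ∀ T ∈ X, S ≠ T → #(S \ T) = d ∨ #(S \ T) = e ∨ #(S \ T) = f)
    (hcard : n.choose 2 < #X) : lagrangeIntegral d e f = true := by
  rw [← hn] at hcard
  have h1 := dvd_of_choose_two_lt_card hw hX hde.ne (hde.trans hef).ne hd hcard
  have h2 := dvd_of_choose_two_lt_card hw hX hde.ne' hef.ne
    (fun S hS T hT hST => by have := hd S hS T hT hST; tauto) hcard
  have h3 := dvd_of_choose_two_lt_card hw hX (hde.trans hef).ne' hef.ne'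
    (fun S hS T hT hST => by have := hd S hS T hT hST; tauto) hcard
  have h2' : ((e : ℤ) - d) * (f - e) ∣ (d : ℤ) * f := by
    rwa [show ((d : ℤ) - e) * (f - e) = -((e - d) * (f - e)) by ring, neg_dvd] at h2
  have h3' : ((f : ℤ) - d) * (f - e) ∣ (d : ℤ) * e := by
    rwa [show ((d : ℤ) - f) * (e - f) = (f - d) * (f - e) by ring] at h3
  rw [← Nat.cast_sub hde.le, ← Nat.cast_sub (hde.trans hef).le] at h1
  rw [← Nat.cast_sub hde.le, ← Nat.cast_sub hef.le] at h2'
  rw [← Nat.cast_sub (hde.trans hef).le, ← Nat.cast_sub hef.le] at h3'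
  simp only [lagrangeIntegral, Bool.and_eq_true, beq_iff_eq]
  exact ⟨⟨Nat.mod_eq_zero_of_dvd (by exact_mod_cast h1),
    Nat.mod_eq_zero_of_dvd (by exact_mod_cast h2')⟩,
    Nat.mod_eq_zero_of_dvd (by exact_mod_cast h3')⟩

theorem choose_three_eq (n : ℕ) : n.choose 3 = n * (n - 1) * (n - 2) / 6 := by
  rw [Nat.choose_eq_descFactorial_div_factorial, Nat.descFactorial_succ, Nat.descFactorial_succ,
    Nat.descFactorial_one]
  congr 1
  ring

theorem harmonicBound_eq (n : ℕ) : harmonicBound n = n.choose 3 - n.choose 2 + n := by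
  rw [harmonicBound, choose_three_eq, Nat.choose_two_right]

theorem starSize_eq (n w : ℕ) : starSize n w = (n - w + 3).choose 3 := by
  rw [starSize, choose_three_eq]
  rfl

theorem choose_two_le_choose_three {n : ℕ} (hn : 11 ≤ n) (hn' : n ≤ 45) :
    n.choose 2 ≤ n.choose 3 ∧ n.choose 2 ≤ harmonicBound n := by
  rw [choose_three_eq, Nat.choose_two_right, harmonicBound]
  interval_cases n <;> decide

theorem choose_two_le_starSize :
    ((List.range' 4 5).all fun w => (List.range' (starLength w) (51 - starLength w)).all fun n =>
      decide (n * (n - 1) / 2 ≤ starSize n w)) = true := by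
  decide +kernel

theorem card_le_harmonicBound (hn : Fintype.card α = n) (hn1 : 11 ≤ n) (hn2 : n ≤ 45) (hw : 4 ≤ w)
    (hwn : 2 * w ≤ n) (hX : ∀ S ∈ X, #S = w) (hd0 : 0 < d) (hde : d < e) (hef : e < f)
    (hfw : f ≤ w)
    (hd : ∀ S ∈ X, ∀ T ∈ X, S ≠ T → #(S \ T) = d ∨ #(S \ T) = e ∨ #(S \ T) = f) :
    #X ≤ harmonicBound n := by
  by_contra! hlt
  have hint := lagrangeIntegral_of_choose_two_lt_card hn (by omega) hX hde hef hd
    ((choose_two_le_choose_three hn1 hn2).2.trans_lt hlt)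
  have h := harmonicTest_eq_true
  simp only [List.all_eq_true, List.mem_range] at h
  have h1 := h f (by omega) e hef d hde
  rw [hint] at h1
  simp only [Bool.not_true, Bool.or_false, Bool.or_eq_true, beq_iff_eq, List.all_eq_true,
    List.mem_range'_1] at h1
  have h2 := h1.resolve_left hd0.ne' w (by omega)
  simp only [harmonicTest, List.all_eq_true, List.mem_range'_1, Bool.or_eq_true,
    decide_eq_true_eq] at h2
  obtain h3 | h3 := h2 n (by omega)
  · have := card_le_of_zonalCoeffTwo_nonpos hn (by omega) hX (by omega) hd0 (hd0.trans hde)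
      (hd0.trans (hde.trans hef)) hd h3
    rw [← harmonicBound_eq] at this
    omega
  · exact hlt.not_ge (card_le_of_lpTest hn hX (by omega) hde.le (hde.trans hef).le hd h3)

theorem card_le_starSize (hn : Fintype.card α = n) (hw : 4 ≤ w) (hw' : w ≤ 8)
    (hn1 : starLength w ≤ n) (hn2 : n ≤ 50) (hn5 : 5 ≤ n)
    (hX : ∀ S ∈ X, #S = w) (hd0 : 0 < d) (hde : d < e) (hef : e < f)
    (hfw : f ≤ w)
    (hd : ∀ S ∈ X, ∀ T ∈ X, S ≠ T → #(S \ T) = d ∨ #(S \ T) = e ∨ #(S \ T) = f) :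
    #X ≤ starSize n w := by
  by_contra! hlt
  have hc := choose_two_le_starSize
  simp only [List.all_eq_true, List.mem_range'_1, decide_eq_true_eq] at hc
  have hc1 := hc w (by omega) n (by omega)
  rw [← Nat.choose_two_right] at hc1
  have hint := lagrangeIntegral_of_choose_two_lt_card hn (by omega) hX hde hef hd
    (hc1.trans_lt hlt)
  have h := starTest_eq_true
  simp only [List.all_eq_true, List.mem_range] at h
  have h1 := h f (by omega) e hef d hde
  rw [hint] at h1
  simp only [Bool.not_true, Bool.or_false, Bool.or_eq_true, beq_iff_eq, List.all_eq_true,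
    List.mem_range'_1] at h1
  have h2 := h1.resolve_left hd0.ne' w (by omega)
  simp only [starTest, List.all_eq_true, List.mem_range'_1] at h2
  exact hlt.not_ge (card_le_of_lpTest hn hX hn5 hde.le (hde.trans hef).le hd (h2 n (by omega)))

end Families

/-! ### The Johnson space -/

section JohnsonSpace

variable {n w : ℕ}

/-- The set of coordinates at which a point of the Johnson space equals one. -/
def johnsonSupport (x : JohnsonSpace n w) : Finset (Fin n) := {i | x.1 i ≠ 0}

theorem card_johnsonSupport (x : JohnsonSpace n w) : #(johnsonSupport x) = w := x.2

theorem johnsonSupport_injective :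
    Function.Injective (johnsonSupport : JohnsonSpace n w → Finset (Fin n)) := by
  intro x y h
  ext i : 2
  have h1 : i ∈ johnsonSupport x ↔ i ∈ johnsonSupport y := by rw [h]
  simp only [johnsonSupport, Finset.mem_filter, Finset.mem_univ, true_and, not_iff_not] at h1
  generalize x.1 i = a at *
  generalize y.1 i = b at *
  revert a b
  decide

theorem johnsonSupport_surjective {S : Finset (Fin n)} (hS : #S = w) :
    ∃ x : JohnsonSpace n w, johnsonSupport x = S := by
  have h : (univ.filter fun i => (if i ∈ S then (1 : ZMod 2) else 0) ≠ 0) = S := by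
    ext i
    simp
  exact ⟨⟨fun i => if i ∈ S then 1 else 0, by rw [hammingNorm, h, hS]⟩, h⟩

theorem johnsonDist_eq (x y : JohnsonSpace n w) :
    johnsonDist n w x y = (#(johnsonSupport x \ johnsonSupport y) : ℝ) := by
  have h1 : #(johnsonSupport y \ johnsonSupport x) = #(johnsonSupport x \ johnsonSupport y) :=
    Finset.card_sdiff_comm ((card_johnsonSupport y).trans (card_johnsonSupport x).symm)
  have h2 : hammingDist x.1 y.1 = #(johnsonSupport x \ johnsonSupport y) +
      #(johnsonSupport y \ johnsonSupport x) := by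
    rw [← Finset.card_union_of_disjoint disjoint_sdiff_sdiff, hammingDist]
    congr 1
    ext i
    simp only [johnsonSupport, Finset.mem_filter, Finset.mem_univ, true_and, Finset.mem_union,
      Finset.mem_sdiff]
    generalize x.1 i = a
    generalize y.1 i = b
    revert a b
    decide
  rw [johnsonDist, h2, h1]
  push_cast
  ring

theorem distanceSet_johnsonDist (X : Finset (JohnsonSpace n w)) :
    distanceSet (johnsonDist n w) X = (Nat.cast : ℕ → ℝ) ''
      (X.offDiag.image fun p => #(johnsonSupport p.1 \ johnsonSupport p.2) : Finset ℕ) := by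
  ext t
  simp only [distanceSet, Set.mem_ofPred_eq, Set.mem_image, Finset.mem_coe, Finset.mem_image,
    Finset.mem_offDiag, Prod.exists, johnsonDist_eq]
  constructor
  · rintro ⟨x, hx, y, hy, hxy, rfl⟩
    exact ⟨_, ⟨x, y, ⟨hx, hy, hxy⟩, rfl⟩, rfl⟩
  · rintro ⟨_, ⟨x, y, ⟨hx, hy, hxy⟩, rfl⟩, rfl⟩
    exact ⟨x, hx, y, hy, hxy, rfl⟩

theorem exists_lt_lt_of_card_eq_three {D : Finset ℕ} (h : #D = 3) :
    ∃ d e f, d < e ∧ e < f ∧ D = {d, e, f} := by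
  obtain ⟨a, b, c, hab, hac, hbc, rfl⟩ := Finset.card_eq_three.1 h
  obtain h1 | h1 := hab.lt_or_gt <;> obtain h2 | h2 := hac.lt_or_gt <;>
    obtain h3 | h3 := hbc.lt_or_gt
  · exact ⟨a, b, c, h1, h3, rfl⟩
  · exact ⟨a, c, b, h2, h3, by ext; simp; tauto⟩
  · omega
  · exact ⟨c, a, b, h2, h1, by ext; simp; tauto⟩
  · exact ⟨b, a, c, h1, h2, by ext; simp; tauto⟩
  · omega
  · exact ⟨b, c, a, h3, h2, by ext; simp; tauto⟩
  · exact ⟨c, b, a, h3, h1, by ext; simp; tauto⟩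

theorem exists_distances_of_isSDistanceSet {X : Finset (JohnsonSpace n w)}
    (hX : IsSDistanceSet (johnsonDist n w) 3 X) :
    ∃ d e f, 0 < d ∧ d < e ∧ e < f ∧ f ≤ w ∧
      ∀ S ∈ X.image johnsonSupport, ∀ T ∈ X.image johnsonSupport, S ≠ T →
        #(S \ T) = d ∨ #(S \ T) = e ∨ #(S \ T) = f := by
  rw [IsSDistanceSet, distanceSet_johnsonDist, Set.ncard_image_of_injective _ Nat.cast_injective,
    Set.ncard_coe_finset] at hX
  obtain ⟨d, e, f, hde, hef, hD⟩ := exists_lt_lt_of_card_eq_three hX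
  have hmem : ∀ t, t = d ∨ t = e ∨ t = f → 0 < t ∧ t ≤ w := by
    intro t ht
    have : t ∈ ({d, e, f} : Finset ℕ) := by simpa using ht
    rw [← hD] at this
    obtain ⟨⟨x, y⟩, hxy, rfl⟩ := Finset.mem_image.1 this
    refine ⟨Finset.card_pos.2 (Finset.sdiff_nonempty.2 fun hsub => ?_), ?_⟩
    · exact (Finset.mem_offDiag.1 hxy).2.2 (johnsonSupport_injective
        (Finset.eq_of_subset_of_card_le hsub (by simp only [card_johnsonSupport, le_refl])))
    · exact (Finset.card_le_card Finset.sdiff_subset).trans (card_johnsonSupport x).le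
  refine ⟨d, e, f, (hmem d (by simp)).1, hde, hef, (hmem f (by simp)).2, ?_⟩
  intro S hS T hT hST
  obtain ⟨x, hx, rfl⟩ := Finset.mem_image.1 hS
  obtain ⟨y, hy, rfl⟩ := Finset.mem_image.1 hT
  have : #(johnsonSupport x \ johnsonSupport y) ∈ ({d, e, f} : Finset ℕ) := by
    rw [← hD]
    exact Finset.mem_image.2 ⟨(x, y), Finset.mem_offDiag.2 ⟨hx, hy,
      fun h => hST (congrArg johnsonSupport h)⟩, rfl⟩
  simpa using this

/-- A bound for families of `w`-sets with three distances bounds `johnsonA n w 3`. -/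
theorem johnsonA_le {B : ℕ}
    (h : ∀ (X : Finset (Finset (Fin n))) (d e f : ℕ), (∀ S ∈ X, #S = w) → 0 < d → d < e → e < f →
      f ≤ w → (∀ S ∈ X, ∀ T ∈ X, S ≠ T → #(S \ T) = d ∨ #(S \ T) = e ∨ #(S \ T) = f) →
      #X ≤ B) :
    johnsonA n w 3 ≤ B := by
  refine csSup_le' ?_
  rintro _ ⟨X, hX, rfl⟩
  obtain ⟨d, e, f, hd0, hde, hef, hfw, hd⟩ := exists_distances_of_isSDistanceSet hX
  rw [← Finset.card_image_of_injective X johnsonSupport_injective]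
  refine h _ d e f ?_ hd0 hde hef hfw hd
  intro S hS
  obtain ⟨x, -, rfl⟩ := Finset.mem_image.1 hS
  exact card_johnsonSupport x

/-- The star over a fixed `(w - 3)`-set is a three-distance set. -/
theorem choose_three_le_johnsonA (hw : 3 ≤ w) (hwn : w + 3 ≤ n) :
    (n - w + 3).choose 3 ≤ johnsonA n w 3 := by
  obtain ⟨Z, -, hZ⟩ := Finset.exists_subset_card_eq
    (show w - 3 ≤ #(univ : Finset (Fin n)) by rw [Finset.card_univ, Fintype.card_fin]; omega)
  have hZc : #Zᶜ = n - w + 3 := by rw [Finset.card_compl, Fintype.card_fin, hZ]; omega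
  let X : Finset (JohnsonSpace n w) := {x | Z ⊆ johnsonSupport x}
  have hlift : ∀ U ⊆ Zᶜ, #U = 3 → ∃ x ∈ X, johnsonSupport x = Z ∪ U := by
    intro U hU hU3
    have hdis : Disjoint Z U := (Finset.subset_compl_iff_disjoint_left.1 hU)
    obtain ⟨x, hx⟩ := johnsonSupport_surjective (w := w) (S := Z ∪ U)
      (by rw [Finset.card_union_of_disjoint hdis, hZ, hU3]; omega)
    exact ⟨x, by simp [X, hx], hx⟩
  have hcard : #X = (n - w + 3).choose 3 := by
    rw [← hZc, ← Finset.card_powersetCard]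
    refine Finset.card_nbij (fun x => johnsonSupport x \ Z) ?_ ?_ ?_
    · intro x hx
      have hx' : Z ⊆ johnsonSupport x := by simpa [X] using hx
      rw [Finset.mem_coe, Finset.mem_powersetCard, Finset.card_sdiff_of_subset hx',
        card_johnsonSupport, hZ]
      exact ⟨fun i hi => Finset.mem_compl.2 (Finset.mem_sdiff.1 hi).2, by omega⟩
    · intro x hx y hy hxy
      have hx' : Z ⊆ johnsonSupport x := by simpa [X] using hx
      have hy' : Z ⊆ johnsonSupport y := by simpa [X] using hy
      apply johnsonSupport_injective
      rw [← Finset.sdiff_union_of_subset hx', ← Finset.sdiff_union_of_subset hy']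
      exact congrArg (· ∪ Z) hxy
    · intro U hU
      obtain ⟨hU1, hU3⟩ := Finset.mem_powersetCard.1 hU
      obtain ⟨x, hxX, hx⟩ := hlift U hU1 hU3
      refine ⟨x, hxX, ?_⟩
      have hdis : Disjoint U Z := (Finset.subset_compl_iff_disjoint_left.1 hU1).symm
      simp only [hx, Finset.union_sdiff_left]
      exact Finset.sdiff_eq_self_of_disjoint hdis
  have hdist : IsSDistanceSet (johnsonDist n w) 3 X := by
    rw [IsSDistanceSet, distanceSet_johnsonDist, Set.ncard_image_of_injective _ Nat.cast_injective,
      Set.ncard_coe_finset]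
    suffices h : (X.offDiag.image fun p => #(johnsonSupport p.1 \ johnsonSupport p.2)) =
        {1, 2, 3} by rw [h]; rfl
    apply Finset.Subset.antisymm
    · intro t ht
      obtain ⟨⟨x, y⟩, hxy, rfl⟩ := Finset.mem_image.1 ht
      obtain ⟨hx, hy, hne⟩ := Finset.mem_offDiag.1 hxy
      have hx' : Z ⊆ johnsonSupport x := by simpa [X] using hx
      have hy' : Z ⊆ johnsonSupport y := by simpa [X] using hy
      have h0 : 0 < #(johnsonSupport x \ johnsonSupport y) :=
        Finset.card_pos.2 (Finset.sdiff_nonempty.2 fun hsub => hne (johnsonSupport_injective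
          (Finset.eq_of_subset_of_card_le hsub (by simp only [card_johnsonSupport, le_refl]))))
      have h3 : #(johnsonSupport x \ johnsonSupport y) ≤ 3 := by
        refine (Finset.card_le_card (Finset.sdiff_subset_sdiff subset_rfl hy')).trans ?_
        rw [Finset.card_sdiff_of_subset hx', card_johnsonSupport, hZ]
        omega
      simp only [Finset.mem_insert, Finset.mem_singleton]
      omega
    · -- two triples of points outside `Z` that share `3 - t` points give the distance `t`
      have key : ∀ t ∈ ({1, 2, 3} : Finset ℕ), ∃ U ⊆ Zᶜ, ∃ V ⊆ Zᶜ, #U = 3 ∧ #V = 3 ∧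
          #(U \ V) = t := by
        intro t ht
        have ht' : 1 ≤ t ∧ t ≤ 3 := by
          simp only [Finset.mem_insert, Finset.mem_singleton] at ht; omega
        obtain ⟨U, hU, hU3⟩ := Finset.exists_subset_card_eq (show 3 ≤ #Zᶜ by omega)
        obtain ⟨V₁, hV₁, hV₁c⟩ := Finset.exists_subset_card_eq (show 3 - t ≤ #U by omega)
        obtain ⟨V₂, hV₂, hV₂c⟩ := Finset.exists_subset_card_eq
          (show t ≤ #(Zᶜ \ U) by rw [Finset.card_sdiff_of_subset hU]; omega)
        have hdU : Disjoint U V₂ := Finset.disjoint_left.2 fun i hi hi' =>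
          (Finset.mem_sdiff.1 (hV₂ hi')).2 hi
        refine ⟨U, hU, V₁ ∪ V₂, Finset.union_subset (hV₁.trans hU)
          (hV₂.trans Finset.sdiff_subset), hU3, ?_, ?_⟩
        · rw [Finset.card_union_of_disjoint (hdU.mono_left hV₁)]; omega
        · have : U \ (V₁ ∪ V₂) = U \ V₁ := by
            ext i
            simp only [Finset.mem_sdiff, Finset.mem_union, not_or]
            exact ⟨fun h => ⟨h.1, h.2.1⟩,
              fun h => ⟨h.1, h.2, Finset.disjoint_left.1 hdU h.1⟩⟩
          rw [this, Finset.card_sdiff_of_subset hV₁]; omega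
      intro t ht
      obtain ⟨U, hU, V, hV, hU3, hV3, rfl⟩ := key t ht
      obtain ⟨x, hxX, hx⟩ := hlift U hU hU3
      obtain ⟨y, hyX, hy⟩ := hlift V hV hV3
      have hd : johnsonSupport x \ johnsonSupport y = U \ V := by
        rw [hx, hy]
        ext i
        have := @hU i
        simp only [Finset.mem_sdiff, Finset.mem_union, Finset.mem_compl] at this ⊢
        tauto
      refine Finset.mem_image.2 ⟨(x, y), Finset.mem_offDiag.2 ⟨hxX, hyX, ?_⟩, congrArg card hd⟩
      intro hxy
      rw [show x = y from hxy, Finset.sdiff_self] at hd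
      rw [← hd] at ht
      simp at ht
  rw [← hcard]
  exact (maxSDistance_isGreatest (johnsonDist n w) 3 ⟨X, hdist⟩).2 ⟨X, hdist, rfl⟩

end JohnsonSpace

/-! ### The two bounds -/

theorem theorem3p5 :
    (∀ n w : ℕ, 11 ≤ n → n ≤ 45 → 4 ≤ w → 2 * w ≤ n →
      (johnsonA n w 3 : ℤ) ≤ (n.choose 3 : ℤ) - (n.choose 2 : ℤ) + (n : ℤ)) ∧
    (∀ n w : ℕ,
      ((11 ≤ n ∧ n ≤ 12 ∧ w = 4) ∨
       (13 ≤ n ∧ n ≤ 15 ∧ 4 ≤ w ∧ w ≤ 5) ∨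
       (16 ≤ n ∧ n ≤ 19 ∧ 4 ≤ w ∧ w ≤ 6) ∨
       (20 ≤ n ∧ n ≤ 24 ∧ 4 ≤ w ∧ w ≤ 7) ∨
       (25 ≤ n ∧ n ≤ 50 ∧ 4 ≤ w ∧ w ≤ 8)) →
      johnsonA n w 3 = (n - w + 3).choose 3) := by
  constructor
  · intro n w hn1 hn2 hw hwn
    have h : johnsonA n w 3 ≤ harmonicBound n :=
      johnsonA_le fun X d e f hX hd0 hde hef hfw hd =>
        card_le_harmonicBound (Fintype.card_fin n) hn1 hn2 hw hwn hX hd0 hde hef hfw hd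
    have h1 := (choose_two_le_choose_three hn1 hn2).1
    rw [harmonicBound_eq] at h
    omega
  · intro n w h
    have hw : 4 ≤ w ∧ w ≤ 8 := by omega
    have hn : starLength w ≤ n ∧ n ≤ 50 := by
      obtain ⟨h4, h8⟩ := hw
      interval_cases w <;> simp [starLength] <;> omega
    refine le_antisymm ?_ (choose_three_le_johnsonA (by omega) (by omega))
    rw [← starSize_eq]
    exact johnsonA_le fun X d e f hX hd0 hde hef hfw hd =>
      card_le_starSize (Fintype.card_fin n) hw.1 hw.2 hn.1 hn.2 (by omega) hX hd0 hde hef hfw hd
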